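/- Let $d\ge 1$, let $\mu\in\mathbb R^d$ be nonzero and let $\Sigma\in\mathbb R^{d\times d}$ be positive definite with $\lVert\mu\rVert^2=\lVert\Sigma\rVert$ (Euclidean norm and spectral norm). For $\kappa\in(0,\infty)$ let $\mathcal D_\kappa$ be the law of $(x,y)$ where $y$ is uniform on $\{0,1\}$, $x\mid y=1\sim N(\mu,\kappa^{-1}\Sigma)$ and $x\mid y=0\sim N(-\mu,\kappa^{-1}\Sigma)$. Let $\mathcal M$ be a probability distribution of pairs $(M,\lambda)$ with support contained in $\{0,1\}^d\times[0,1]$. Let $S=\{(x_i,y_i)\}_{i=1}^n$ be i.i.d. from $\mathcal D_\kappa$ and, independently of $S$, let $(M_{i,j},\lambda_{i,j})_{i,j=1}^n$ be i.i.d. from $\mathcal M$. With the logistic loss $l(z)=\log(1+e^{-z})$ and $\odot$ the entrywise product, put $$\tilde x_{i,j}=M_{i,j}\odot x_i+(\mathbf 1-M_{i,j})\odot x_j,\qquad \tilde y_{i,j}=\lambda_{i,j}y_i+(1-\lambda_{i,j})y_j,$$ $$\mathcal L_S^{\mathrm{mask}}(w)=\frac1{n^2}\sum_{i,j=1}^n\Big(\tilde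 y_{i,j}\,l(w^\top\tilde x_{i,j})+(1-\tilde y_{i,j})\,l(-w^\top\tilde x_{i,j})\Big),\qquad w\in\mathbb R^d,$$ and let $\mathbb E_\kappa[\mathcal L_S^{\mathrm{mask}}(w)]$ be its expectation over $S$ and all $(M_{i,j},\lambda_{i,j})$. For nonzero $u,v\in\mathbb R^d$ let $\mathrm{sim}(u,v)=\frac{u^\top v}{\lVert u\rVert\lVert v\rVert}$. Assume that, for $(M,\lambda)\sim\mathcal M$, the support of the random vector $\mu\odot(2M-\mathbf 1)$ spans $\mathbb R^d$, and that $\mathbb P[\lambda\,\mathbf 1_{M=M_0}\notin\{0,1\}]>0$ for every $M_0\in\mathrm{support}(M)$. Then there are constants $C>0$ and $\kappa_0>0$, depending only on $d,\mu,\Sigma$ and $\mathcal M$, such that for all $\kappa\ge\kappa_0$, all $\epsilon,\delta\in(0,1)$ and all $n\in\mathbb N$ with $$n\ \ge\ \frac{C}{\epsilon^4}\Big(1+\log\frac1\epsilon+\log\frac1\delta\Big),$$ the loss $\mathcal L_S^{\mathrm{mask}}(w)$ is integrable for every $w$, the expected loss $w\mapsto\mathbb E_\kappa[\mathcal L_S^{\mathrm{mask}}(w)]$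 has a unique minimizer $w^*_{\mathrm{mask},\kappa}$ on $\mathbb R^d$, and with probability at least $1-\delta$ (over $S$ and the masks) $\mathcal L_S^{\mathrm{mask}}$ has a unique minimizer $\hat w^*_{\mathrm{mask},S}$ on $\mathbb R^d$, and it satisfies $$\mathrm{sim}\big(\hat w^*_{\mathrm{mask},S},\,w^*_{\mathrm{mask},\kappa}\big)\ \ge\ 1-\epsilon .$$ -/

import Mathlib

open MeasureTheory ProbabilityTheory

noncomputable section

namespace MaskMixup

/-- The logistic loss `l(z) = log (1 + exp (-z))`. -/
def logisticLoss (z : ℝ) : ℝ := Real.log (1 + Real.exp (-z))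

/-- Cosine similarity `⟨u, v⟩ / (‖u‖ ‖v‖)`, meaningful for nonzero vectors.
If one of the vectors is zero, the value is `0`. -/
def cosSim {d : ℕ} (u v : EuclideanSpace ℝ (Fin d)) : ℝ :=
  inner ℝ u v / (‖u‖ * ‖v‖)

/-- The data distribution `D_κ` on pairs (data point, label): the label is uniform on `{0, 1}`,
the point is `N(m, κ⁻¹ Σ)` given label `1` and `N(-m, κ⁻¹ Σ)` given label `0`. -/
def dataDist {d : ℕ} (m : EuclideanSpace ℝ (Fin d)) (S : Matrix (Fin d) (Fin d) ℝ) (κ : ℝ) :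
    Measure (EuclideanSpace ℝ (Fin d) × ℝ) :=
  (2⁻¹ : ENNReal) • (multivariateGaussian m (κ⁻¹ • S)).prod (Measure.dirac 1) +
  (2⁻¹ : ENNReal) • (multivariateGaussian (-m) (κ⁻¹ • S)).prod (Measure.dirac 0)

/-- A law `𝓜` of pairs (mask `M`, ratio `lam`) is supported in `{0,1}^d × [0,1]`. -/
def IsMaskLaw {d : ℕ} (𝓜 : Measure ((Fin d → ℝ) × ℝ)) : Prop :=
  𝓜.support ⊆ {p | (∀ k, p.1 k = 0 ∨ p.1 k = 1) ∧ p.2 ∈ Set.Icc (0 : ℝ) 1}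

/-- The vector `m ⊙ (2 M - 1)`. -/
def signFlip {d : ℕ} (m : EuclideanSpace ℝ (Fin d)) (M : Fin d → ℝ) : EuclideanSpace ℝ (Fin d) :=
  WithLp.toLp 2 fun k => m k * (2 * M k - 1)

/-- The assumption on masking: the support of the random vector `m ⊙ (2 M - 1)` spans `ℝ^d`, and
`P[lam * 1_{M = M₀} ∉ {0, 1}] > 0` for every `M₀` in the support of `M`, where `(M, lam) ∼ 𝓜`. -/
def MaskAssumption {d : ℕ} (m : EuclideanSpace ℝ (Fin d)) (𝓜 : Measure ((Fin d → ℝ) × ℝ)) :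
    Prop :=
  Submodule.span ℝ (𝓜.map fun p => signFlip m p.1).support = ⊤ ∧
  ∀ M₀ ∈ (𝓜.map Prod.fst).support,
    0 < 𝓜 {p | p.2 * Set.indicator {M₀} (fun _ => (1 : ℝ)) p.1 ∉ ({0, 1} : Set ℝ)}

/-- The masked point `M ⊙ x + (1 - M) ⊙ x'`. -/
def maskPoint {d : ℕ} (M : Fin d → ℝ) (x x' : EuclideanSpace ℝ (Fin d)) :
    EuclideanSpace ℝ (Fin d) :=
  WithLp.toLp 2 fun k => M k * x k + (1 - M k) * x' k

/-- All the randomness of the masking-based Mixup loss with `n` samples: the training set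
`(x_i, y_i)`, `i ∈ [n]`, and the masks and ratios `(M_{i,j}, lam_{i,j})`, `i, j ∈ [n]`. -/
abbrev Sample (d n : ℕ) : Type :=
  (Fin n → EuclideanSpace ℝ (Fin d) × ℝ) × (Fin n × Fin n → (Fin d → ℝ) × ℝ)

/-- The law of the randomness: the `(x_i, y_i)` are i.i.d. with law `D_κ`, the
`(M_{i,j}, lam_{i,j})` are i.i.d. with law `𝓜`, and the two families are independent. -/
def sampleLaw {d : ℕ} (m : EuclideanSpace ℝ (Fin d)) (S : Matrix (Fin d) (Fin d) ℝ)
    (𝓜 : Measure ((Fin d → ℝ) × ℝ)) (κ : ℝ) (n : ℕ) : Measure (Sample d n) :=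
  (Measure.pi fun _ : Fin n => dataDist m S κ).prod (Measure.pi fun _ : Fin n × Fin n => 𝓜)

/-- The mixed point `x̃_{i,j}`. -/
def mixedPoint {d n : ℕ} (ω : Sample d n) (i j : Fin n) : EuclideanSpace ℝ (Fin d) :=
  maskPoint (ω.2 (i, j)).1 (ω.1 i).1 (ω.1 j).1

/-- The mixed label `ỹ_{i,j} = lam_{i,j} y_i + (1 - lam_{i,j}) y_j`. -/
def mixedLabel {d n : ℕ} (ω : Sample d n) (i j : Fin n) : ℝ :=
  (ω.2 (i, j)).2 * (ω.1 i).2 + (1 - (ω.2 (i, j)).2) * (ω.1 j).2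

/-- The empirical masking-based Mixup loss. -/
def maskLoss {d n : ℕ} (ω : Sample d n) (w : EuclideanSpace ℝ (Fin d)) : ℝ :=
  1 / (n : ℝ) ^ 2 * ∑ i : Fin n, ∑ j : Fin n,
    (mixedLabel ω i j * logisticLoss (inner ℝ w (mixedPoint ω i j)) +
      (1 - mixedLabel ω i j) * logisticLoss (-inner ℝ w (mixedPoint ω i j)))

/-- The expected masking-based Mixup loss, the expectation being over the training set and the
masks. -/
def expectedMaskLoss {d : ℕ} (m : EuclideanSpace ℝ (Fin d)) (S : Matrix (Fin d) (Fin d) ℝ)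
    (𝓜 : Measure ((Fin d → ℝ) × ℝ)) (κ : ℝ) (n : ℕ) (w : EuclideanSpace ℝ (Fin d)) : ℝ :=
  ∫ ω, maskLoss ω w ∂(sampleLaw m S 𝓜 κ n)

/-- `w` is a global minimizer of `f`, and the only one. -/
def IsUniqueMinimizer {d : ℕ} (f : EuclideanSpace ℝ (Fin d) → ℝ) (w : EuclideanSpace ℝ (Fin d)) :
    Prop :=
  (∀ v, f w ≤ f v) ∧ ∀ u, (∀ v, f u ≤ f v) → u = w

end MaskMixup

end

noncomputable section

namespace MaskMixup

/-! Only the gradient at one deterministic point has to concentrate; uniform convergence is not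
needed. Let w* minimize the expected loss. If the empirical loss is α-strongly convex on a ball
containing w* and the empirical minimizer ŵ, then ‖ŵ - w*‖ ≤ 2‖∇L_S(w*)‖/α
(`norm_sub_minimizer_le`), and ‖ŵ - w*‖ ≤ (ε/2)‖w*‖ gives the similarity (`one_sub_le_cosSim`). The
expected gradient vanishes at w*, so ∇L_S(w*) is a centred average.

Curvature and coercivity: the mask has finitely many atoms, so the spanning assumption becomes a
frame bound for the vectors μ ⊙ (2M - 1), and the assumption on λ gives, for every atom M, a
positive probability of ratios in [τ, 1 - τ] (`exists_masks`). For large κ, a pair with x_i near μ,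
x_j near -μ and mask M has a mixed point near μ ⊙ (2M - 1) and the mixed label λ. Its loss grows
linearly in both directions and is strongly convex on bounded sets along that vector; the frame
bound supplies a suitable M for every direction. Once every M has a positive frequency, the
empirical loss is coercive and strongly convex on balls (`IsGoodSample.coercive`,
`IsGoodSample.strong`). This event has probability at least 1/2, so the expected loss inherits both
properties.

Size of w*: the expected gradient at 0 has a component along -μ bounded below uniformly in n and κ,
and smoothness turns this into a lower bound of ‖w*‖ (`norm_expectedGrad_zero_ge`,
`norm_gradient_zero_le`).

Concentration: the n² summands are dependent. The ordered pairs are split into 2n colours such that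
pairs of one colour share no index, hence have independent summands; convexity of exp averages the
colours, and exponential moments give a tail exp(-c n η²) for 0 ≤ η ≤ 1
(`measureReal_mean_pairs_ge_le`). With η proportional to ε, already n of order ε⁻²(1 + log(1/δ))
suffices. -/

/-! ### Quadratic bounds for the logistic loss -/

/-- The mean value theorem for f minus its quadratic minorant: monotonicity of the derivative
relative to s fixes the sign of the slope. The sign of c is free, so c < 0 applied to -f yields
upper bounds. -/
theorem quadratic_lower_bound {f f' : ℝ → ℝ} (hf : ∀ x, HasDerivAt f (f' x) x) {s t c : ℝ}
    (h : ∀ x ∈ Set.uIcc s t, c * (x - s) ^ 2 ≤ (f' x - f' s) * (x - s)) :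
    f s + f' s * (t - s) + c / 2 * (t - s) ^ 2 ≤ f t := by
  set φ : ℝ → ℝ := fun x => f x - f' s * (x - s) - c / 2 * (x - s) ^ 2 with hφ
  have hd : ∀ x, HasDerivAt φ (f' x - f' s - c * (x - s)) x := by
    intro x
    have h1 : HasDerivAt (fun x : ℝ => x - s) 1 x := (hasDerivAt_id x).sub_const s
    have h2 := ((hf x).sub (h1.const_mul (f' s))).sub ((h1.pow 2).const_mul (c / 2))
    exact h2.congr_deriv (by simp; ring)
  rcases lt_trichotomy s t with hst | hst | hst
  · obtain ⟨ξ, hξ, he⟩ := exists_hasDerivAt_eq_slope φ _ hst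
      (fun x _ => (hd x).continuousAt.continuousWithinAt) (fun x _ => hd x)
    have h1 := h ξ (by rw [Set.uIcc_of_le hst.le]; exact ⟨hξ.1.le, hξ.2.le⟩)
    have h2 : 0 < ξ - s := sub_pos.2 hξ.1
    have h3 : 0 ≤ f' ξ - f' s - c * (ξ - s) := by
      by_contra hneg
      push Not at hneg
      nlinarith
    rw [he, le_div_iff₀ (sub_pos.2 hst)] at h3
    simp only [hφ] at h3
    nlinarith
  · subst hst; simp
  · obtain ⟨ξ, hξ, he⟩ := exists_hasDerivAt_eq_slope φ _ hst
      (fun x _ => (hd x).continuousAt.continuousWithinAt) (fun x _ => hd x)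
    have h1 := h ξ (by rw [Set.uIcc_of_ge hst.le]; exact ⟨hξ.1.le, hξ.2.le⟩)
    have h2 : ξ - s < 0 := sub_neg.2 hξ.2
    have h3 : f' ξ - f' s - c * (ξ - s) ≤ 0 := by
      by_contra hneg
      push Not at hneg
      nlinarith
    rw [he, div_le_iff₀ (sub_pos.2 hst)] at h3
    simp only [hφ] at h3
    nlinarith

theorem sigmoid_sub_eq (s t : ℝ) : ∃ ξ ∈ Set.uIcc s t,
    Real.sigmoid t - Real.sigmoid s = Real.sigmoid ξ * (1 - Real.sigmoid ξ) * (t - s) := by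
  rcases lt_trichotomy s t with hst | hst | hst
  · obtain ⟨ξ, hξ, he⟩ := exists_hasDerivAt_eq_slope Real.sigmoid _ hst
      (fun x _ => (Real.hasDerivAt_sigmoid x).continuousAt.continuousWithinAt)
      (fun x _ => Real.hasDerivAt_sigmoid x)
    refine ⟨ξ, by rw [Set.uIcc_of_le hst.le]; exact ⟨hξ.1.le, hξ.2.le⟩, ?_⟩
    rw [he, div_mul_cancel₀ _ (sub_pos.2 hst).ne']
  · exact ⟨s, by simp, by simp [hst]⟩
  · obtain ⟨ξ, hξ, he⟩ := exists_hasDerivAt_eq_slope Real.sigmoid _ hst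
      (fun x _ => (Real.hasDerivAt_sigmoid x).continuousAt.continuousWithinAt)
      (fun x _ => Real.hasDerivAt_sigmoid x)
    refine ⟨ξ, by rw [Set.uIcc_of_ge hst.le]; exact ⟨hξ.1.le, hξ.2.le⟩, ?_⟩
    have := (sub_pos.2 hst).ne'
    rw [he]; field_simp; ring

/-- The loss `y l(t) + (1 - y) l(-t)` of the prediction `t` for the soft label `y`. -/
def pairLoss (y t : ℝ) : ℝ := y * logisticLoss t + (1 - y) * logisticLoss (-t)

theorem logisticLoss_nonneg (t : ℝ) : 0 ≤ logisticLoss t :=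
  Real.log_nonneg (by linarith [Real.exp_pos (-t)])

theorem neg_le_logisticLoss (t : ℝ) : -t ≤ logisticLoss t := by
  rw [logisticLoss, Real.le_log_iff_exp_le (by positivity)]
  linarith

theorem logisticLoss_le (t : ℝ) : logisticLoss t ≤ Real.log 2 + |t| := by
  rw [logisticLoss, Real.log_le_iff_le_exp (by positivity), Real.exp_add, Real.exp_log two_pos]
  have h1 : Real.exp (-t) ≤ Real.exp |t| := Real.exp_le_exp.2 (neg_le_abs t)
  have h2 : 1 ≤ Real.exp |t| := Real.one_le_exp (abs_nonneg t)
  linarith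

theorem logisticLoss_zero : logisticLoss 0 = Real.log 2 := by
  norm_num [logisticLoss]

theorem logisticLoss_neg (t : ℝ) : logisticLoss (-t) = logisticLoss t + t := by
  rw [logisticLoss, logisticLoss, neg_neg, ← Real.log_exp t,
    ← Real.log_mul (by positivity) (by positivity), Real.log_exp, add_mul, ← Real.exp_add]
  simp [add_comm]

theorem hasDerivAt_logisticLoss (t : ℝ) : HasDerivAt logisticLoss (Real.sigmoid t - 1) t := by
  have h1 : HasDerivAt (fun x : ℝ => 1 + Real.exp (-x)) (-Real.exp (-t)) t := by
    simpa using ((hasDerivAt_neg t).exp).const_add 1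
  refine (h1.log (by positivity)).congr_deriv ?_
  have : 1 + Real.exp (-t) ≠ 0 := by positivity
  rw [Real.sigmoid_def]
  field_simp
  ring

theorem continuous_logisticLoss : Continuous logisticLoss :=
  continuous_iff_continuousAt.2 fun t => (hasDerivAt_logisticLoss t).continuousAt

theorem pairLoss_eq (y t : ℝ) : pairLoss y t = logisticLoss t + (1 - y) * t := by
  rw [pairLoss, logisticLoss_neg]; ring

theorem pairLoss_zero (y : ℝ) : pairLoss y 0 = Real.log 2 := by
  simp [pairLoss_eq, logisticLoss_zero]

theorem continuous_pairLoss : Continuous fun p : ℝ × ℝ => pairLoss p.1 p.2 := by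
  have := continuous_logisticLoss
  unfold pairLoss
  fun_prop

theorem hasDerivAt_pairLoss (y t : ℝ) : HasDerivAt (pairLoss y) (Real.sigmoid t - y) t := by
  have h := (hasDerivAt_logisticLoss t).add ((hasDerivAt_id t).const_mul (1 - y))
  have e : pairLoss y = logisticLoss + fun x => (1 - y) * id x := by
    ext x; simp [pairLoss_eq]
  rw [e]
  exact h.congr_deriv (by ring)

theorem pairLoss_upper (y s t : ℝ) :
    pairLoss y t ≤ pairLoss y s + (Real.sigmoid s - y) * (t - s) + 1 / 2 * (t - s) ^ 2 := by
  -- The crude bound σ(1 - σ) ≤ 1 on the second derivative is enough.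
  have h := quadratic_lower_bound (f := fun x => - pairLoss y x)
    (f' := fun x => -(Real.sigmoid x - y)) (fun x => (hasDerivAt_pairLoss y x).neg)
    (s := s) (t := t) (c := -1) (by
      intro x _
      obtain ⟨ξ, -, he⟩ := sigmoid_sub_eq s x
      have h1 := Real.sigmoid_pos ξ
      have h2 := Real.sigmoid_lt_one ξ
      have h3 : -(Real.sigmoid x - y) - -(Real.sigmoid s - y) =
        -(Real.sigmoid ξ * (1 - Real.sigmoid ξ) * (x - s)) := by rw [← he]; ring
      rw [h3]
      nlinarith [mul_nonneg (by nlinarith : 0 ≤ 1 - Real.sigmoid ξ * (1 - Real.sigmoid ξ))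
        (sq_nonneg (x - s))])
  linarith

/-- The modulus of strong convexity of the logistic loss on `[-T, T]`. -/
def logisticModulus (T : ℝ) : ℝ := Real.sigmoid T * (1 - Real.sigmoid T)

theorem logisticModulus_pos (T : ℝ) : 0 < logisticModulus T :=
  mul_pos (Real.sigmoid_pos T) (sub_pos.2 (Real.sigmoid_lt_one T))

theorem pairLoss_strong_lower (y : ℝ) {s t T : ℝ} (hs : |s| ≤ T) (ht : |t| ≤ T) :
    pairLoss y s + (Real.sigmoid s - y) * (t - s) + logisticModulus T / 2 * (t - s) ^ 2
      ≤ pairLoss y t := by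
  refine quadratic_lower_bound (hasDerivAt_pairLoss y) fun x hx => ?_
  obtain ⟨ξ, hξ, he⟩ := sigmoid_sub_eq s x
  have hξ' : ξ ∈ Set.Icc (-T) T := by
    have hs' : s ∈ Set.Icc (-T) T := abs_le.1 hs
    have ht' : t ∈ Set.Icc (-T) T := abs_le.1 ht
    have hx' := Set.uIcc_subset_Icc hs' ht' hx
    exact Set.uIcc_subset_Icc hs' hx' hξ
  have h1 : Real.sigmoid ξ ≤ Real.sigmoid T := Real.sigmoid_le hξ'.2
  have h2 : 1 - Real.sigmoid T ≤ Real.sigmoid ξ := by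
    rw [← Real.sigmoid_neg]; exact Real.sigmoid_le hξ'.1
  have h3 : Real.sigmoid x - y - (Real.sigmoid s - y) =
    Real.sigmoid ξ * (1 - Real.sigmoid ξ) * (x - s) := by rw [← he]; ring
  rw [h3, mul_assoc, ← sq]
  refine mul_le_mul_of_nonneg_right ?_ (sq_nonneg _)
  unfold logisticModulus
  -- With a = σ(T) and p = σ(ξ): p(1 - p) - a(1 - a) = (a - p)(p - (1 - a)).
  nlinarith [mul_nonneg (sub_nonneg.2 h1) (sub_nonneg.2 h2)]

theorem pairLoss_lower (y s t : ℝ) :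
    pairLoss y s + (Real.sigmoid s - y) * (t - s) ≤ pairLoss y t := by
  have h := pairLoss_strong_lower y (le_max_left |s| |t|) (le_max_right |s| |t|)
  have := mul_nonneg (half_pos (logisticModulus_pos (max |s| |t|))).le (sq_nonneg (t - s))
  linarith

theorem pairLoss_nonneg {y : ℝ} (hy : y ∈ Set.Icc (0 : ℝ) 1) (t : ℝ) : 0 ≤ pairLoss y t :=
  add_nonneg (mul_nonneg hy.1 (logisticLoss_nonneg _))
    (mul_nonneg (sub_nonneg.2 hy.2) (logisticLoss_nonneg _))

/-- Whatever the sign of t, one of the two logistic terms is at least |t|, and its weight is at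
least τ. -/
theorem mul_abs_le_pairLoss {y τ : ℝ} (hτ : 0 ≤ τ) (hy : y ∈ Set.Icc τ (1 - τ)) (t : ℝ) :
    τ * |t| ≤ pairLoss y t := by
  have h1 := logisticLoss_nonneg t
  have h2 := logisticLoss_nonneg (-t)
  have h3 := neg_le_logisticLoss t
  have h4 := neg_le_logisticLoss (-t)
  have hy1 := hy.1
  have hy2 := hy.2
  unfold pairLoss
  rcases abs_cases t with ⟨h, _⟩ | ⟨h, _⟩ <;> rw [h] <;>
    nlinarith [mul_nonneg (hτ.trans hy1) h1, mul_nonneg (by linarith : 0 ≤ 1 - y) h2]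

theorem abs_pairLoss_le {y : ℝ} (hy : y ∈ Set.Icc (0 : ℝ) 1) (t : ℝ) :
    |pairLoss y t| ≤ Real.log 2 + |t| := by
  rw [abs_of_nonneg (pairLoss_nonneg hy t), pairLoss]
  have h1 := logisticLoss_le t
  have h2 := logisticLoss_le (-t)
  rw [abs_neg] at h2
  nlinarith [hy.1, hy.2]

/-! ### Independence of functions of disjoint pairs -/

/-- Induction on the number of blocks: a new block is independent of the union of the others.
Integrability is not needed, since the product formula for two independent measurable functions
holds without it. -/
theorem integral_prod_blocks {ι α Ω : Type*} {mΩ : MeasurableSpace Ω} {P : Measure Ω}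
    {𝓧 : ι → Type*} {m𝓧 : ∀ i, MeasurableSpace (𝓧 i)} {X : ∀ i, Ω → 𝓧 i}
    (hX : iIndepFun X P) (mX : ∀ i, Measurable (X i)) (S : α → Finset ι) (A : Finset α)
    (hS : (A : Set α).PairwiseDisjoint S) (F : ∀ a, (∀ i : S a, 𝓧 i) → ℝ)
    (mF : ∀ a, Measurable (F a)) :
    ∫ ω, ∏ a ∈ A, F a (fun i => X i ω) ∂P = ∏ a ∈ A, ∫ ω, F a (fun i => X i ω) ∂P := by
  classical
  have := hX.isProbabilityMeasure
  induction A using Finset.induction_on with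
  | empty => simp
  | insert a A ha ih =>
    have hA : (A : Set α).PairwiseDisjoint S :=
      hS.subset (by simp)
    rw [Finset.prod_insert ha, ← ih hA]
    simp_rw [Finset.prod_insert ha]
    set T := A.biUnion S with hT
    have hdisj : Disjoint (S a) T := by
      rw [hT, Finset.disjoint_biUnion_right]
      intro b hb
      exact hS (by simp) (by simp [hb]) (by rintro rfl; exact ha hb)
    have hind := hX.indepFun_finset (S a) T hdisj mX
    let G : (∀ i : T, 𝓧 i) → ℝ := fun x => ∏ b ∈ A.attach,
      F b.1 (fun i => x ⟨i.1, Finset.mem_biUnion.2 ⟨b.1, b.2, i.2⟩⟩)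
    have mG : Measurable G := by
      refine Finset.measurable_prod _ fun b _ => (mF b.1).comp ?_
      exact measurable_pi_lambda _ fun i => measurable_pi_apply _
    have hG : ∀ ω, ∏ b ∈ A, F b (fun i => X i ω) = G (fun i => X i ω) := by
      intro ω
      simp only [G]
      exact (Finset.prod_attach A fun b => F b (fun i => X i ω)).symm
    simp_rw [hG]
    refine (hind.comp (mF a) mG).integral_mul_eq_mul_integral ?_ ?_
    · exact ((mF a).comp (measurable_pi_lambda _ fun i => mX i)).aestronglyMeasurable
    · exact (mG.comp (measurable_pi_lambda _ fun i => mX i)).aestronglyMeasurable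

section Pairs

variable {Z W : Type} [MeasurableSpace Z] [MeasurableSpace W]

/-- The law of a family of i.i.d. points and an independent family of i.i.d. marks of the ordered
pairs of indices. -/
def pairLaw (ν : Measure Z) (μ : Measure W) (n : ℕ) :
    Measure ((Fin n → Z) × (Fin n × Fin n → W)) :=
  (Measure.pi fun _ => ν).prod (Measure.pi fun _ => μ)

variable {ν : Measure Z} {μ : Measure W} [IsProbabilityMeasure ν] [IsProbabilityMeasure μ] {n : ℕ}

instance : IsProbabilityMeasure (pairLaw ν μ n) := by unfold pairLaw; infer_instance

instance coordMeasurableSpace (s : Fin n ⊕ Fin n × Fin n) :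
    MeasurableSpace (Sum.elim (fun _ => Z) (fun _ => W) s : Type) :=
  match s with
  | .inl _ => inferInstanceAs (MeasurableSpace Z)
  | .inr _ => inferInstanceAs (MeasurableSpace W)

/-- The coordinates of a family of points and marks. -/
def coord (s : Fin n ⊕ Fin n × Fin n) (ω : (Fin n → Z) × (Fin n × Fin n → W)) :
    (Sum.elim (fun _ => Z) (fun _ => W) s : Type) :=
  match s with
  | .inl i => ω.1 i
  | .inr p => ω.2 p

theorem measurable_coord (s : Fin n ⊕ Fin n × Fin n) : Measurable (coord (Z := Z) (W := W) s) := by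
  rcases s with i | p
  · exact (measurable_pi_apply i).comp measurable_fst
  · exact (measurable_pi_apply p).comp measurable_snd

theorem measurePreserving_point (i : Fin n) :
    MeasurePreserving (fun ω : (Fin n → Z) × (Fin n × Fin n → W) => ω.1 i) (pairLaw ν μ n) ν :=
  (measurePreserving_eval (fun _ : Fin n => ν) i).comp measurePreserving_fst

theorem measurePreserving_mark (p : Fin n × Fin n) :
    MeasurePreserving (fun ω : (Fin n → Z) × (Fin n × Fin n → W) => ω.2 p) (pairLaw ν μ n) μ :=
  (measurePreserving_eval (fun _ : Fin n × Fin n => μ) p).comp measurePreserving_snd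

/-- A product measure over a disjoint union of index sets is the product of the two product
measures, so points and marks together form one independent family. -/
theorem iIndepFun_coord {ν : Measure Z} {μ : Measure W} [hν : IsProbabilityMeasure ν]
    [hμ : IsProbabilityMeasure μ] : iIndepFun (coord (Z := Z) (W := W) (n := n)) (pairLaw ν μ n) := by
  let κ : ∀ s : Fin n ⊕ Fin n × Fin n, Measure (Sum.elim (fun _ => Z) (fun _ => W) s : Type) :=
    fun s => match s with
    | .inl _ => (ν : Measure Z)
    | .inr _ => (μ : Measure W)
  have hκ : ∀ s, IsProbabilityMeasure (κ s) := by
    rintro (i | p)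
    · exact hν
    · exact hμ
  have hmp := measurePreserving_sumPiEquivProdPi_symm κ
  rw [iIndepFun_iff_map_fun_eq_pi_map fun s => (measurable_coord s).aemeasurable]
  have h1 : ∀ s, (pairLaw ν μ n).map (coord s) = κ s := by
    rintro (i | p)
    · have h := (measurePreserving_point (ν := ν) (μ := μ) i).map_eq
      exact h
    · have h := (measurePreserving_mark (ν := ν) (μ := μ) p).map_eq
      exact h
  simp_rw [h1]
  rw [← hmp.map_eq]
  congr 1
  ext ω s
  rcases s with i | p <;> rfl

/-- The factor of a pair depends on the block made of its two points and its mark. Diagonal pairs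
are allowed: only indices of different pairs must differ. -/
theorem integral_prod_matching {f : Z × Z × W → ℝ} (hf : Measurable f)
    (A : Finset (Fin n × Fin n))
    (hA : ∀ a ∈ A, ∀ b ∈ A, a ≠ b → a.1 ≠ b.1 ∧ a.1 ≠ b.2 ∧ a.2 ≠ b.1 ∧ a.2 ≠ b.2) :
    ∫ ω, ∏ a ∈ A, f (ω.1 a.1, ω.1 a.2, ω.2 a) ∂(pairLaw ν μ n) =
      ∏ a ∈ A, ∫ ω, f (ω.1 a.1, ω.1 a.2, ω.2 a) ∂(pairLaw ν μ n) := by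
  classical
  let S : Fin n × Fin n → Finset (Fin n ⊕ Fin n × Fin n) :=
    fun a => {Sum.inl a.1, Sum.inl a.2, Sum.inr a}
  let F : ∀ a, (∀ s : S a, (Sum.elim (fun _ => Z) (fun _ => W) s.1 : Type)) → ℝ := fun a x =>
    f (x ⟨Sum.inl a.1, by simp [S]⟩, x ⟨Sum.inl a.2, by simp [S]⟩, x ⟨Sum.inr a, by simp [S]⟩)
  refine integral_prod_blocks (F := F) (iIndepFun_coord (ν := ν) (μ := μ) (n := n))
    measurable_coord S A ?_ ?_
  · intro a ha b hb hab
    obtain ⟨h1, h2, h3, h4⟩ := hA a ha b hb hab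
    rw [Function.onFun, Finset.disjoint_left]
    simp only [S, Finset.mem_insert, Finset.mem_singleton]
    rintro s (rfl | rfl | rfl) <;> simp_all
  · intro a
    refine hf.comp ?_
    exact (measurable_pi_apply (⟨Sum.inl a.1, by simp [S]⟩ : S a)).prodMk
      ((measurable_pi_apply (⟨Sum.inl a.2, by simp [S]⟩ : S a)).prodMk
        (measurable_pi_apply (⟨Sum.inr a, by simp [S]⟩ : S a)))

end Pairs

/-! ### Moment generating functions from one exponential moment -/

theorem exp_le_one_add_add_sq_mul_exp (x : ℝ) :
    Real.exp x ≤ 1 + x + x ^ 2 * Real.exp |x| := by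
  have h := Complex.norm_exp_sub_sum_le_norm_mul_exp (x : ℂ) 2
  have e : Complex.exp (x : ℂ) - ∑ m ∈ Finset.range 2, (x : ℂ) ^ m / (m.factorial : ℂ) =
      ((Real.exp x - (1 + x) : ℝ) : ℂ) := by
    simp [Finset.sum_range_succ]
  rw [e, Complex.norm_real, Complex.norm_real, Real.norm_eq_abs, Real.norm_eq_abs, sq_abs] at h
  linarith [le_abs_self (Real.exp x - (1 + x))]

theorem sq_le_eight_mul_exp (y : ℝ) : y ^ 2 ≤ 8 * Real.exp (|y| / 2) := by
  have h := Real.quadratic_le_exp_of_nonneg (by positivity : 0 ≤ |y| / 2)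
  nlinarith [sq_abs y, abs_nonneg y]

/-- Half of the exponent in exp |y| absorbs the factor y² of the remainder, the other half absorbs
exp |s y|; hence the restriction |s| ≤ 1/2. -/
theorem exp_mul_le {s : ℝ} (hs : |s| ≤ 1 / 2) (y : ℝ) :
    Real.exp (s * y) ≤ 1 + s * y + 8 * s ^ 2 * Real.exp |y| := by
  have h1 := exp_le_one_add_add_sq_mul_exp (s * y)
  have h2 : Real.exp |s * y| ≤ Real.exp (|y| / 2) := by
    rw [abs_mul]
    exact Real.exp_le_exp.2 (by nlinarith [abs_nonneg y])
  have h3 := sq_le_eight_mul_exp y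
  have h4 : Real.exp |y| = Real.exp (|y| / 2) * Real.exp (|y| / 2) := by
    rw [← Real.exp_add]; ring_nf
  have h5 : (s * y) ^ 2 * Real.exp |s * y| ≤ 8 * s ^ 2 * Real.exp |y| := by
    calc (s * y) ^ 2 * Real.exp |s * y| = s ^ 2 * (y ^ 2 * Real.exp |s * y|) := by ring
      _ ≤ s ^ 2 * (8 * Real.exp (|y| / 2) * Real.exp (|y| / 2)) := by gcongr
      _ = _ := by rw [h4]; ring
  linarith

section

variable {Ω : Type*} {mΩ : MeasurableSpace Ω} {P : Measure Ω} {Y : Ω → ℝ}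

theorem integrable_of_exp_abs (hY : AEStronglyMeasurable Y P)
    (hI : Integrable (fun ω => Real.exp |Y ω|) P) : Integrable Y P := by
  refine hI.mono hY (ae_of_all _ fun ω => ?_)
  rw [Real.norm_eq_abs, Real.norm_eq_abs, abs_of_pos (Real.exp_pos _)]
  linarith [Real.add_one_le_exp |Y ω|]

theorem integrable_exp_mul_of_exp_abs (hY : AEStronglyMeasurable Y P)
    (hI : Integrable (fun ω => Real.exp |Y ω|) P) {s : ℝ} (hs : |s| ≤ 1 / 2) :
    Integrable (fun ω => Real.exp (s * Y ω)) P := by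
  refine hI.mono (Real.continuous_exp.comp_aestronglyMeasurable (hY.const_mul s))
    (ae_of_all _ fun ω => ?_)
  rw [Real.norm_eq_abs, Real.norm_eq_abs, abs_of_pos (Real.exp_pos _), abs_of_pos (Real.exp_pos _)]
  refine Real.exp_le_exp.2 ((le_abs_self _).trans ?_)
  rw [abs_mul]
  nlinarith [abs_nonneg (Y ω)]

theorem integral_exp_mul_le [IsProbabilityMeasure P] (hY : AEStronglyMeasurable Y P)
    (hI : Integrable (fun ω => Real.exp |Y ω|) P) {B : ℝ}
    (hB : ∫ ω, Real.exp |Y ω| ∂P ≤ B) {s : ℝ} (hs : |s| ≤ 1 / 2) :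
    ∫ ω, Real.exp (s * Y ω) ∂P ≤ Real.exp (s * ∫ ω, Y ω ∂P + 8 * B * s ^ 2) := by
  have hYi := integrable_of_exp_abs hY hI
  have hA : Integrable (fun ω => 1 + s * Y ω) P := (integrable_const _).add (hYi.const_mul s)
  calc ∫ ω, Real.exp (s * Y ω) ∂P
      ≤ ∫ ω, (1 + s * Y ω + 8 * s ^ 2 * Real.exp |Y ω|) ∂P := by
        refine integral_mono (integrable_exp_mul_of_exp_abs hY hI hs) ?_
          fun ω => exp_mul_le hs (Y ω)
        exact hA.add (hI.const_mul _)
    _ = 1 + s * ∫ ω, Y ω ∂P + 8 * s ^ 2 * ∫ ω, Real.exp |Y ω| ∂P := by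
        rw [integral_add hA (hI.const_mul _),
          integral_add (integrable_const _) (hYi.const_mul s), integral_const_mul,
          integral_const_mul]
        simp
    _ ≤ 1 + (s * ∫ ω, Y ω ∂P + 8 * B * s ^ 2) := by
        nlinarith [mul_le_mul_of_nonneg_left hB (sq_nonneg s)]
    _ ≤ _ := by rw [add_comm]; exact Real.add_one_le_exp _

end

/-! ### A Chernoff bound for averages over all ordered pairs -/

section Pairs

variable {Z W : Type} [MeasurableSpace Z] [MeasurableSpace W]
variable {ν : Measure Z} {μ : Measure W} [IsProbabilityMeasure ν] [IsProbabilityMeasure μ] {n : ℕ}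

/-- A colouring of the ordered pairs such that pairs of the same colour are disjoint. -/
def pairColour [NeZero n] (p : Fin n × Fin n) : Fin n × Bool := (p.1 + p.2, decide (p.1 ≤ p.2))

/-- The sum modulo n and one index determine the other index, so two pairs of one colour that share
an index are equal or swapped. The order bit excludes a swap of two distinct indices. -/
theorem pairColour_disjoint [NeZero n] {a b : Fin n × Fin n} (h : pairColour a = pairColour b)
    (hab : a ≠ b) : a.1 ≠ b.1 ∧ a.1 ≠ b.2 ∧ a.2 ≠ b.1 ∧ a.2 ≠ b.2 := by
  obtain ⟨a1, a2⟩ := a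
  obtain ⟨b1, b2⟩ := b
  simp only [pairColour, Prod.mk.injEq, decide_eq_decide] at h
  obtain ⟨hs, hle⟩ := h
  have key : a1 = b2 → a2 = b1 → (a1, a2) = (b1, b2) := by
    rintro rfl rfl
    have : a1 = a2 := by
      rcases le_total a1 a2 with h | h
      · exact le_antisymm h (hle.1 h)
      · exact le_antisymm (hle.2 h) h
    simp [this]
  refine ⟨fun h => hab ?_, fun h => hab ?_, fun h => hab ?_, fun h => hab ?_⟩ <;>
    dsimp only at h
  · subst h; rw [add_left_cancel hs]
  · subst h; rw [add_comm b1] at hs; exact key rfl (add_left_cancel hs)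
  · subst h; rw [add_comm a1] at hs; exact key (add_left_cancel hs) rfl
  · subst h; rw [add_right_cancel hs]

theorem card_filter_pairColour_le [NeZero n] (q : Fin n × Bool) :
    (Finset.univ.filter fun p : Fin n × Fin n => pairColour p = q).card ≤ n := by
  calc _ ≤ (Finset.univ : Finset (Fin n)).card := by
        refine Finset.card_le_card_of_injOn Prod.fst (fun _ _ => Finset.mem_coe.2 (Finset.mem_univ _)) ?_
        intro a ha b hb h
        by_contra hab
        simp only [Finset.coe_filter, Finset.mem_univ, true_and, Set.mem_ofPred_eq] at ha hb
        exact (pairColour_disjoint (ha.trans hb.symm) hab).1 h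
    _ = n := by simp

variable {f : Z × Z × W → ℝ} {B : ℝ}

theorem integral_exp_colour_le [NeZero n] (hf : Measurable f)
    (hI : ∀ p : Fin n × Fin n,
      Integrable (fun ω => Real.exp |f (ω.1 p.1, ω.1 p.2, ω.2 p)|) (pairLaw ν μ n))
    (hB : ∀ p : Fin n × Fin n,
      ∫ ω, Real.exp |f (ω.1 p.1, ω.1 p.2, ω.2 p)| ∂(pairLaw ν μ n) ≤ B) (hB0 : 0 ≤ B)
    {e : Fin n × Fin n → ℝ} (he : ∀ p, e p = ∫ ω, f (ω.1 p.1, ω.1 p.2, ω.2 p) ∂(pairLaw ν μ n))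
    {s : ℝ} (hs : |s| ≤ 1 / 2) (q : Fin n × Bool) :
    Integrable (fun ω => Real.exp (s * ∑ p with pairColour p = q,
      (f (ω.1 p.1, ω.1 p.2, ω.2 p) - e p))) (pairLaw ν μ n) ∧
    ∫ ω, Real.exp (s * ∑ p with pairColour p = q,
      (f (ω.1 p.1, ω.1 p.2, ω.2 p) - e p)) ∂(pairLaw ν μ n) ≤ Real.exp (n * (8 * B * s ^ 2)) := by
  set P := pairLaw ν μ n with hP
  set A : Finset (Fin n × Fin n) := Finset.univ.filter fun p => pairColour p = q with hA
  have hm : ∀ p : Fin n × Fin n, Measurable fun ω : (Fin n → Z) × (Fin n × Fin n → W) =>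
      f (ω.1 p.1, ω.1 p.2, ω.2 p) := fun p => hf.comp (by fun_prop)
  have hprod := integral_prod_matching (ν := ν) (μ := μ) (n := n)
    (f := fun x => Real.exp (s * f x)) (Real.measurable_exp.comp (hf.const_mul s)) A (by
      intro a ha b hb hab
      simp only [hA, Finset.mem_filter] at ha hb
      exact pairColour_disjoint (ha.2.trans hb.2.symm) hab)
  rw [← hP] at hprod
  have hpos : ∀ p : Fin n × Fin n, 0 < ∫ ω, Real.exp (s * f (ω.1 p.1, ω.1 p.2, ω.2 p)) ∂P :=
    fun p => integral_exp_pos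
      (integrable_exp_mul_of_exp_abs (hm p).aestronglyMeasurable (hI p) hs)
  have hint : Integrable (fun ω => ∏ a ∈ A, Real.exp (s * f (ω.1 a.1, ω.1 a.2, ω.2 a))) P := by
    -- The integral is a product of positive numbers, and a nonzero Bochner integral forces
    -- integrability.
    refine Integrable.of_integral_ne_zero ?_
    rw [hprod]
    exact (Finset.prod_pos fun p _ => hpos p).ne'
  have hexp : ∀ ω : (Fin n → Z) × (Fin n × Fin n → W),
      Real.exp (s * ∑ p ∈ A, (f (ω.1 p.1, ω.1 p.2, ω.2 p) - e p)) =
      Real.exp (-(s * ∑ p ∈ A, e p)) * ∏ a ∈ A, Real.exp (s * f (ω.1 a.1, ω.1 a.2, ω.2 a)) := by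
    intro ω
    rw [← Real.exp_sum, ← Real.exp_add, Finset.sum_sub_distrib, ← Finset.mul_sum]
    ring_nf
  simp_rw [hexp]
  refine ⟨hint.const_mul _, ?_⟩
  rw [integral_const_mul, hprod]
  calc Real.exp (-(s * ∑ p ∈ A, e p)) *
        ∏ a ∈ A, ∫ ω, Real.exp (s * f (ω.1 a.1, ω.1 a.2, ω.2 a)) ∂P
      ≤ Real.exp (-(s * ∑ p ∈ A, e p)) * ∏ a ∈ A, Real.exp (s * e a + 8 * B * s ^ 2) := by
        gcongr with a ha
        rw [he a]
        exact integral_exp_mul_le (hm a).aestronglyMeasurable (hI a) (hB a) hs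
    _ = Real.exp (A.card * (8 * B * s ^ 2)) := by
        rw [← Real.exp_sum, ← Real.exp_add, Finset.sum_add_distrib, ← Finset.mul_sum,
          Finset.sum_const, nsmul_eq_mul]
        ring_nf
    _ ≤ _ := by
        gcongr
        exact card_filter_pairColour_le q

/-- Hoeffding's device for U-statistics: the exponential of the mean is, by convexity, at most the
average over the 2n colours of exponentials of sums of at most n independent terms. -/
theorem measureReal_mean_pairs_ge_le [NeZero n] (hf : Measurable f)
    (hI : ∀ p : Fin n × Fin n,
      Integrable (fun ω => Real.exp |f (ω.1 p.1, ω.1 p.2, ω.2 p)|) (pairLaw ν μ n))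
    (hB : ∀ p : Fin n × Fin n,
      ∫ ω, Real.exp |f (ω.1 p.1, ω.1 p.2, ω.2 p)| ∂(pairLaw ν μ n) ≤ B)
    {η : ℝ} (hη : 0 ≤ η) (hη1 : η ≤ 1) :
    (pairLaw ν μ n).real {ω | η ≤ 1 / (n : ℝ) ^ 2 * ∑ p : Fin n × Fin n,
      (f (ω.1 p.1, ω.1 p.2, ω.2 p) - ∫ ω, f (ω.1 p.1, ω.1 p.2, ω.2 p) ∂(pairLaw ν μ n))} ≤
      Real.exp (-(n * η ^ 2 / (128 * B))) := by
  set P := pairLaw ν μ n with hP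
  have hn : (0 : ℝ) < n := by exact_mod_cast Nat.pos_of_ne_zero (NeZero.ne n)
  have hB1 : 1 ≤ B := by
    refine le_trans ?_ (hB (0, 0))
    calc (1 : ℝ) = ∫ _, (1 : ℝ) ∂P := by simp
      _ ≤ _ := integral_mono (integrable_const _) (hI (0, 0)) fun ω =>
        Real.one_le_exp (abs_nonneg _)
  set g : Fin n × Fin n → (Fin n → Z) × (Fin n × Fin n → W) → ℝ := fun p ω =>
    f (ω.1 p.1, ω.1 p.2, ω.2 p) - ∫ ω, f (ω.1 p.1, ω.1 p.2, ω.2 p) ∂P with hg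
  set U : (Fin n → Z) × (Fin n × Fin n → W) → ℝ := fun ω =>
    1 / (n : ℝ) ^ 2 * ∑ p : Fin n × Fin n, g p ω with hU
  have hgm : ∀ p, Measurable (g p) := fun p => (hf.comp (by fun_prop)).sub_const _
  have hUm : Measurable U := (Finset.measurable_sum _ fun p _ => hgm p).const_mul _
  -- Weights 1/(2n) on the colours force s = 2t/n. The exponent -tη + 8nBs² = -tη + 32Bt²/n is
  -- smallest at this t, with value -nη²/(128B).
  set t : ℝ := n * η / (64 * B) with ht
  set s : ℝ := η / (32 * B) with hs
  have hs0 : 0 ≤ s := by positivity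
  have hs1 : |s| ≤ 1 / 2 := by
    rw [abs_of_nonneg hs0, hs, div_le_iff₀ (by positivity)]
    linarith
  have hcol := fun q => integral_exp_colour_le (ν := ν) (μ := μ) hf hI hB (by linarith)
    (e := fun p => ∫ ω, f (ω.1 p.1, ω.1 p.2, ω.2 p) ∂P) (fun _ => rfl) hs1 q
  have hJ : ∀ ω, Real.exp (t * U ω) ≤ ∑ q : Fin n × Bool, 1 / (2 * n : ℝ) *
      Real.exp (s * ∑ p with pairColour p = q, g p ω) := by
    intro ω
    have h1 : t * U ω = ∑ q : Fin n × Bool, (1 / (2 * n : ℝ)) •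
        (s * ∑ p with pairColour p = q, g p ω) := by
      have h2 := Finset.sum_fiberwise (s := (Finset.univ : Finset (Fin n × Fin n)))
        (g := pairColour) (f := fun p => g p ω)
      simp_rw [smul_eq_mul, ← Finset.mul_sum, h2, hU, ht, hs]
      field_simp
      ring
    rw [h1]
    have h3 := convexOn_exp.map_sum_le (t := (Finset.univ : Finset (Fin n × Bool)))
      (w := fun _ => 1 / (2 * n : ℝ)) (p := fun q => s * ∑ p with pairColour p = q, g p ω)
      (fun _ _ => by positivity) (by
        simp only [Finset.sum_const, Finset.card_univ, Fintype.card_prod, Fintype.card_fin,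
          Fintype.card_bool, nsmul_eq_mul]
        push_cast; field_simp) (fun _ _ => Set.mem_univ _)
    simpa only [smul_eq_mul] using h3
  have hsum : Integrable (fun ω => ∑ q : Fin n × Bool, 1 / (2 * n : ℝ) *
      Real.exp (s * ∑ p with pairColour p = q, g p ω)) P :=
    integrable_finsetSum _ fun q _ => (hcol q).1.const_mul _
  have hUi : Integrable (fun ω => Real.exp (t * U ω)) P := by
    refine hsum.mono (Real.measurable_exp.comp (hUm.const_mul t)).aestronglyMeasurable
      (ae_of_all _ fun ω => ?_)
    rw [Real.norm_eq_abs, Real.norm_eq_abs, abs_of_pos (Real.exp_pos _)]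
    exact (hJ ω).trans (le_abs_self _)
  have hmgf : mgf U P t ≤ Real.exp (n * (8 * B * s ^ 2)) := by
    calc mgf U P t ≤ ∫ ω, ∑ q : Fin n × Bool, 1 / (2 * n : ℝ) *
        Real.exp (s * ∑ p with pairColour p = q, g p ω) ∂P := integral_mono hUi hsum hJ
      _ = ∑ q : Fin n × Bool, 1 / (2 * n : ℝ) *
          ∫ ω, Real.exp (s * ∑ p with pairColour p = q, g p ω) ∂P := by
          rw [integral_finsetSum _ fun q _ => (hcol q).1.const_mul _]
          simp_rw [integral_const_mul]
          rfl
      _ ≤ ∑ q : Fin n × Bool, 1 / (2 * n : ℝ) * Real.exp (n * (8 * B * s ^ 2)) := by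
          gcongr with q
          exact (hcol q).2
      _ = _ := by
          simp only [Finset.sum_const, Finset.card_univ, Fintype.card_prod, Fintype.card_fin,
            Fintype.card_bool, nsmul_eq_mul]
          push_cast; field_simp
  refine (measure_ge_le_exp_mul_mgf (X := U) η (by positivity) hUi).trans ?_
  calc Real.exp (-t * η) * mgf U P t
      ≤ Real.exp (-t * η) * Real.exp (n * (8 * B * s ^ 2)) := by gcongr
    _ = _ := by
      rw [← Real.exp_add, ht, hs]
      congr 1
      field_simp
      ring

end Pairs

/-! ### Moments of Gaussian vectors -/

section Gaussian

variable {d : ℕ} {S : Matrix (Fin d) (Fin d) ℝ}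

theorem integral_coord_multivariateGaussian (hS : S.PosSemidef) (m : EuclideanSpace ℝ (Fin d))
    (k : Fin d) : ∫ x, x k ∂(multivariateGaussian m S) = m k := by
  have h := measurePreserving_eval_multivariateGaussian (μ := m) hS (i := k)
  have h2 := integral_map (μ := multivariateGaussian m S) h.measurable.aemeasurable
    (f := fun x : ℝ => x) (by fun_prop)
  rw [h.map_eq] at h2
  rw [← h2, integral_id_gaussianReal]

theorem integrable_exp_mul_coord (hS : S.PosSemidef) (m : EuclideanSpace ℝ (Fin d))
    (k : Fin d) (t : ℝ) :
    Integrable (fun x => Real.exp (t * x k)) (multivariateGaussian m S) := by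
  have h := measurePreserving_eval_multivariateGaussian (μ := m) hS (i := k)
  have h2 := integrable_exp_mul_gaussianReal (μ := m k) (v := (S k k).toNNReal) t
  rw [← h.map_eq] at h2
  exact h2.comp_measurable h.measurable

theorem integral_exp_mul_coord (hS : S.PosSemidef) (m : EuclideanSpace ℝ (Fin d))
    (k : Fin d) (t : ℝ) :
    ∫ x, Real.exp (t * x k) ∂(multivariateGaussian m S) =
      Real.exp (m k * t + S k k * t ^ 2 / 2) := by
  have h := measurePreserving_eval_multivariateGaussian (μ := m) hS (i := k)
  have h2 := mgf_gaussianReal h.map_eq t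
  rw [Real.coe_toNNReal _ hS.diag_nonneg] at h2
  exact h2

theorem exp_two_abs_le (x : ℝ) :
    Real.exp (2 * |x|) ≤ Real.exp (2 * x) + Real.exp (-2 * x) := by
  rcases abs_cases x with ⟨h, -⟩ | ⟨h, -⟩ <;> rw [h]
  · linarith [Real.exp_pos (-2 * x)]
  · rw [show 2 * -x = -2 * x by ring]; linarith [Real.exp_pos (2 * x)]

theorem integrable_exp_two_abs_coord (hS : S.PosSemidef) (m : EuclideanSpace ℝ (Fin d))
    (k : Fin d) : Integrable (fun x => Real.exp (2 * |x k|)) (multivariateGaussian m S) := by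
  refine ((integrable_exp_mul_coord hS m k 2).add (integrable_exp_mul_coord hS m k (-2))).mono
    (by fun_prop) (ae_of_all _ fun x => ?_)
  rw [Real.norm_eq_abs, Real.norm_eq_abs, abs_of_pos (Real.exp_pos _)]
  exact (exp_two_abs_le _).trans (le_abs_self _)

theorem abs_coord_le_norm (m : EuclideanSpace ℝ (Fin d)) (k : Fin d) : |m k| ≤ ‖m‖ := by
  simpa using PiLp.norm_apply_le m k

theorem integral_exp_two_abs_coord_le (hS : S.PosSemidef) (m : EuclideanSpace ℝ (Fin d))
    (k : Fin d) : ∫ x, Real.exp (2 * |x k|) ∂(multivariateGaussian m S) ≤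
      2 * Real.exp (2 * ‖m‖ + 2 * S.trace) := by
  have hk : S k k ≤ S.trace :=
    Finset.single_le_sum (f := fun i => S i i) (fun i _ => hS.diag_nonneg) (Finset.mem_univ k)
  have hm := abs_le.1 (abs_coord_le_norm m k)
  calc ∫ x, Real.exp (2 * |x k|) ∂(multivariateGaussian m S)
      ≤ ∫ x, (Real.exp (2 * x k) + Real.exp (-2 * x k)) ∂(multivariateGaussian m S) :=
        integral_mono (integrable_exp_two_abs_coord hS m k)
          ((integrable_exp_mul_coord hS m k 2).add (integrable_exp_mul_coord hS m k (-2)))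
          fun x => exp_two_abs_le _
    _ = Real.exp (m k * 2 + S k k * 2 ^ 2 / 2) + Real.exp (m k * (-2) + S k k * (-2) ^ 2 / 2) := by
        rw [integral_add (integrable_exp_mul_coord hS m k 2) (integrable_exp_mul_coord hS m k (-2)),
          integral_exp_mul_coord hS, integral_exp_mul_coord hS]
    _ ≤ Real.exp (2 * ‖m‖ + 2 * S.trace) + Real.exp (2 * ‖m‖ + 2 * S.trace) := by
        refine add_le_add (Real.exp_le_exp.2 ?_) (Real.exp_le_exp.2 ?_) <;> linarith
    _ = _ := by ring

theorem integral_norm_sub_sq_multivariateGaussian (hS : S.PosSemidef)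
    (m : EuclideanSpace ℝ (Fin d)) :
    Integrable (fun x => ‖x - m‖ ^ 2) (multivariateGaussian m S) ∧
    ∫ x, ‖x - m‖ ^ 2 ∂(multivariateGaussian m S) = S.trace := by
  have hL : ∀ k, MemLp (fun x : EuclideanSpace ℝ (Fin d) => x k) 2 (multivariateGaussian m S) :=
    fun k => IsGaussian.memLp_dual (multivariateGaussian m S) (EuclideanSpace.proj k) 2 (by simp)
  have hI : ∀ k, Integrable (fun x : EuclideanSpace ℝ (Fin d) => (x k - m k) ^ 2)
      (multivariateGaussian m S) := fun k => ((hL k).sub (memLp_const _)).integrable_sq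
  have he : ∀ x : EuclideanSpace ℝ (Fin d), ‖x - m‖ ^ 2 = ∑ k, (x k - m k) ^ 2 := by
    intro x
    simp [EuclideanSpace.norm_sq_eq]
  simp_rw [he]
  refine ⟨integrable_finsetSum _ fun k _ => hI k, ?_⟩
  rw [integral_finsetSum _ fun k _ => hI k]
  refine Finset.sum_congr rfl fun k _ => ?_
  rw [Matrix.diag_apply, ← variance_eval_multivariateGaussian (μ := m) hS k,
    variance_eq_integral (by fun_prop), integral_coord_multivariateGaussian hS]

/-- Markov's inequality for ‖x - m‖², whose mean is the trace. -/
theorem half_le_multivariateGaussian_closedBall (hS : S.PosSemidef)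
    (m : EuclideanSpace ℝ (Fin d)) {r : ℝ} (hr : 0 < r) (h : 2 * S.trace ≤ r ^ 2) :
    1 / 2 ≤ (multivariateGaussian m S).real {x | ‖x - m‖ ≤ r} := by
  obtain ⟨hI, he⟩ := integral_norm_sub_sq_multivariateGaussian hS m
  have h1 := mul_meas_ge_le_integral_of_nonneg (ae_of_all _ fun x => sq_nonneg ‖x - m‖) hI (r ^ 2)
  rw [he] at h1
  have hm : MeasurableSet {x : EuclideanSpace ℝ (Fin d) | ‖x - m‖ ≤ r} :=
    measurableSet_le (by fun_prop) measurable_const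
  have h2 : (multivariateGaussian m S).real {x | ‖x - m‖ ≤ r}ᶜ ≤
      (multivariateGaussian m S).real {x | r ^ 2 ≤ ‖x - m‖ ^ 2} := by
    refine measureReal_mono fun x hx => ?_
    have hx' : r < ‖x - m‖ := not_le.1 hx
    exact pow_le_pow_left₀ hr.le hx'.le 2
  rw [probReal_compl_eq_one_sub hm] at h2
  have h3 : 0 < r ^ 2 := by positivity
  nlinarith

end Gaussian

/-! ### Moments of the data distribution, uniform in κ ≥ 1 -/

section Data

variable {d : ℕ} (m : EuclideanSpace ℝ (Fin d)) (S : Matrix (Fin d) (Fin d) ℝ) (κ : ℝ)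

instance : IsProbabilityMeasure (dataDist m S κ) := by
  constructor
  simp [dataDist, ENNReal.inv_two_add_inv_two]

variable {m S κ}

theorem dataDist_eq : dataDist m S κ =
    (2⁻¹ : ENNReal) • (multivariateGaussian m (κ⁻¹ • S)).map (fun x => (x, (1 : ℝ))) +
    (2⁻¹ : ENNReal) • (multivariateGaussian (-m) (κ⁻¹ • S)).map (fun x => (x, (0 : ℝ))) := by
  rw [dataDist, Measure.prod_dirac, Measure.prod_dirac]

theorem integrable_dataDist {g : EuclideanSpace ℝ (Fin d) × ℝ → ℝ} (hg : Measurable g)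
    (h1 : Integrable (fun x => g (x, 1)) (multivariateGaussian m (κ⁻¹ • S)))
    (h0 : Integrable (fun x => g (x, 0)) (multivariateGaussian (-m) (κ⁻¹ • S))) :
    Integrable g (dataDist m S κ) := by
  rw [dataDist_eq]
  refine Integrable.add_measure (Integrable.smul_measure ?_ (by simp))
    (Integrable.smul_measure ?_ (by simp))
  · exact (integrable_map_measure hg.aestronglyMeasurable (by fun_prop)).2 h1
  · exact (integrable_map_measure hg.aestronglyMeasurable (by fun_prop)).2 h0

theorem integral_dataDist {g : EuclideanSpace ℝ (Fin d) × ℝ → ℝ} (hg : Measurable g)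
    (h1 : Integrable (fun x => g (x, 1)) (multivariateGaussian m (κ⁻¹ • S)))
    (h0 : Integrable (fun x => g (x, 0)) (multivariateGaussian (-m) (κ⁻¹ • S))) :
    ∫ z, g z ∂(dataDist m S κ) =
      1 / 2 * ∫ x, g (x, 1) ∂(multivariateGaussian m (κ⁻¹ • S)) +
      1 / 2 * ∫ x, g (x, 0) ∂(multivariateGaussian (-m) (κ⁻¹ • S)) := by
  rw [dataDist_eq, integral_add_measure, integral_smul_measure, integral_smul_measure,
    integral_map (by fun_prop) hg.aestronglyMeasurable,
    integral_map (by fun_prop) hg.aestronglyMeasurable]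
  · simp
  · refine Integrable.smul_measure ?_ (by simp)
    exact (integrable_map_measure hg.aestronglyMeasurable (by fun_prop)).2 h1
  · refine Integrable.smul_measure ?_ (by simp)
    exact (integrable_map_measure hg.aestronglyMeasurable (by fun_prop)).2 h0

theorem dataDist_real_apply {A : Set (EuclideanSpace ℝ (Fin d) × ℝ)} (hA : MeasurableSet A) :
    (dataDist m S κ).real A =
      1 / 2 * (multivariateGaussian m (κ⁻¹ • S)).real {x | (x, 1) ∈ A} +
      1 / 2 * (multivariateGaussian (-m) (κ⁻¹ • S)).real {x | (x, 0) ∈ A} := by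
  have h1 : Measurable fun x : EuclideanSpace ℝ (Fin d) => (x, (1 : ℝ)) := by fun_prop
  have h0 : Measurable fun x : EuclideanSpace ℝ (Fin d) => (x, (0 : ℝ)) := by fun_prop
  rw [Measure.real, dataDist_eq, Measure.add_apply, Measure.smul_apply, Measure.smul_apply,
    Measure.map_apply h1 hA, Measure.map_apply h0 hA, smul_eq_mul, smul_eq_mul,
    ENNReal.toReal_add (ENNReal.mul_ne_top (by simp) (measure_ne_top _ _))
      (ENNReal.mul_ne_top (by simp) (measure_ne_top _ _)), ENNReal.toReal_mul, ENNReal.toReal_mul]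
  simp [Measure.real, Set.preimage]

theorem ae_dataDist_label : ∀ᵐ z ∂(dataDist m S κ), z.2 = 0 ∨ z.2 = 1 := by
  have hm : MeasurableSet {z : EuclideanSpace ℝ (Fin d) × ℝ | z.2 = 0 ∨ z.2 = 1} :=
    (measurableSet_eq_fun measurable_snd measurable_const).union
      (measurableSet_eq_fun measurable_snd measurable_const)
  rw [dataDist_eq, ae_add_measure_iff]
  constructor <;> refine Measure.ae_smul_measure ?_ _ <;>
    rw [ae_map_iff (by fun_prop) hm] <;> simp

variable (hS : S.PosSemidef) (hκ : 1 ≤ κ)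
include hS hκ

theorem posSemidef_scaled : (κ⁻¹ • S).PosSemidef :=
  hS.smul (inv_nonneg.2 (zero_le_one.trans hκ))

theorem trace_scaled_le : (κ⁻¹ • S).trace ≤ S.trace := by
  have h : 0 ≤ S.trace := Finset.sum_nonneg fun i _ => hS.diag_nonneg
  rw [Matrix.trace_smul, smul_eq_mul]
  exact mul_le_of_le_one_left h (inv_le_one_of_one_le₀ hκ)

theorem integrable_exp_two_abs_dataDist (k : Fin d) :
    Integrable (fun z => Real.exp (2 * |z.1 k|)) (dataDist m S κ) :=
  integrable_dataDist (by fun_prop)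
    (integrable_exp_two_abs_coord (posSemidef_scaled hS hκ) m k)
    (integrable_exp_two_abs_coord (posSemidef_scaled hS hκ) (-m) k)

theorem integral_exp_two_abs_dataDist_le (k : Fin d) :
    ∫ z, Real.exp (2 * |z.1 k|) ∂(dataDist m S κ) ≤ 2 * Real.exp (2 * ‖m‖ + 2 * S.trace) := by
  have hS' := posSemidef_scaled hS hκ
  rw [integral_dataDist (by fun_prop) (integrable_exp_two_abs_coord hS' m k)
    (integrable_exp_two_abs_coord hS' (-m) k)]
  have h1 := integral_exp_two_abs_coord_le hS' m k
  have h2 := integral_exp_two_abs_coord_le hS' (-m) k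
  rw [norm_neg] at h2
  have h3 : Real.exp (2 * ‖m‖ + 2 * (κ⁻¹ • S).trace) ≤ Real.exp (2 * ‖m‖ + 2 * S.trace) := by
    gcongr
    exact trace_scaled_le hS hκ
  simp only
  linarith

theorem integrable_coord_gaussian (m : EuclideanSpace ℝ (Fin d)) (k : Fin d) :
    Integrable (fun x => x k) (multivariateGaussian m (κ⁻¹ • S)) := by
  refine (integrable_exp_two_abs_coord (posSemidef_scaled hS hκ) m k).mono (by fun_prop)
    (ae_of_all _ fun x => ?_)
  rw [Real.norm_eq_abs, Real.norm_eq_abs, abs_of_pos (Real.exp_pos _)]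
  linarith [Real.add_one_le_exp (2 * |x k|), abs_nonneg (x k)]

theorem integrable_coord_dataDist (k : Fin d) :
    Integrable (fun z => z.1 k) (dataDist m S κ) :=
  integrable_dataDist (by fun_prop) (integrable_coord_gaussian hS hκ m k)
    (integrable_coord_gaussian hS hκ (-m) k)

theorem integral_coord_dataDist (k : Fin d) : ∫ z, z.1 k ∂(dataDist m S κ) = 0 := by
  rw [integral_dataDist (by fun_prop) (integrable_coord_gaussian hS hκ m k)
    (integrable_coord_gaussian hS hκ (-m) k),
    integral_coord_multivariateGaussian (posSemidef_scaled hS hκ),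
    integral_coord_multivariateGaussian (posSemidef_scaled hS hκ)]
  simp

theorem integrable_label_mul_coord_dataDist (k : Fin d) :
    Integrable (fun z => (1 / 2 - z.2) * z.1 k) (dataDist m S κ) :=
  integrable_dataDist (by fun_prop) ((integrable_coord_gaussian hS hκ m k).const_mul (1 / 2 - 1))
    ((integrable_coord_gaussian hS hκ (-m) k).const_mul (1 / 2 - 0))

theorem integral_label_mul_coord_dataDist (k : Fin d) :
    ∫ z, (1 / 2 - z.2) * z.1 k ∂(dataDist m S κ) = -(m k / 2) := by
  rw [integral_dataDist (by fun_prop) ((integrable_coord_gaussian hS hκ m k).const_mul (1 / 2 - 1))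
    ((integrable_coord_gaussian hS hκ (-m) k).const_mul (1 / 2 - 0))]
  simp only [integral_const_mul]
  rw [integral_coord_multivariateGaussian (posSemidef_scaled hS hκ),
    integral_coord_multivariateGaussian (posSemidef_scaled hS hκ), PiLp.neg_apply]
  ring

omit hS hκ in
theorem integrable_label_dataDist : Integrable (fun z => 1 / 2 - z.2) (dataDist m S κ) :=
  integrable_dataDist (by fun_prop) (integrable_const (1 / 2 - 1 : ℝ)) (integrable_const (1 / 2 - 0 : ℝ))

omit hS hκ in
theorem integral_label_dataDist : ∫ z, (1 / 2 - z.2) ∂(dataDist m S κ) = 0 := by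
  rw [integral_dataDist (by fun_prop) (integrable_const (1 / 2 - 1 : ℝ)) (integrable_const (1 / 2 - 0 : ℝ))]
  simp; norm_num

/-- One factor 1/2 is the probability of the label, the other that of the ball given the label; the
covariance has trace tr(S)/κ ≤ r²/2. -/
theorem quarter_le_dataDist_one {r : ℝ} (hr : 0 < r) (h : 2 * S.trace ≤ κ * r ^ 2) :
    1 / 4 ≤ (dataDist m S κ).real {z | z.2 = 1 ∧ ‖z.1 - m‖ ≤ r} := by
  have hκ0 : 0 < κ := zero_lt_one.trans_le hκ
  have hm : MeasurableSet {z : EuclideanSpace ℝ (Fin d) × ℝ | z.2 = 1 ∧ ‖z.1 - m‖ ≤ r} :=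
    .inter (measurableSet_eq_fun measurable_snd measurable_const) <|
      measurableSet_le (f := fun z : EuclideanSpace ℝ (Fin d) × ℝ => ‖z.1 - m‖) (by fun_prop)
        measurable_const
  have hb := half_le_multivariateGaussian_closedBall (posSemidef_scaled hS hκ) m hr (by
    rw [Matrix.trace_smul, smul_eq_mul, ← mul_assoc, mul_comm 2, mul_assoc,
      inv_mul_le_iff₀ hκ0]
    exact h)
  rw [dataDist_real_apply hm]
  simp
  norm_num at hb
  linarith

theorem quarter_le_dataDist_zero {r : ℝ} (hr : 0 < r) (h : 2 * S.trace ≤ κ * r ^ 2) :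
    1 / 4 ≤ (dataDist m S κ).real {z | z.2 = 0 ∧ ‖z.1 + m‖ ≤ r} := by
  have hκ0 : 0 < κ := zero_lt_one.trans_le hκ
  have hm : MeasurableSet {z : EuclideanSpace ℝ (Fin d) × ℝ | z.2 = 0 ∧ ‖z.1 + m‖ ≤ r} :=
    .inter (measurableSet_eq_fun measurable_snd measurable_const) <|
      measurableSet_le (f := fun z : EuclideanSpace ℝ (Fin d) × ℝ => ‖z.1 + m‖) (by fun_prop)
        measurable_const
  have hb := half_le_multivariateGaussian_closedBall (posSemidef_scaled hS hκ) (-m) hr (by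
    rw [Matrix.trace_smul, smul_eq_mul, ← mul_assoc, mul_comm 2, mul_assoc,
      inv_mul_le_iff₀ hκ0]
    exact h)
  rw [dataDist_real_apply hm]
  simp [sub_neg_eq_add] at hb ⊢
  linarith

end Data

/-! ### What the masking assumption provides -/

/-- For a spanning family, u ↦ ∑ |⟨u, v a⟩| is positive off 0, hence bounded below on the compact
unit sphere; the largest summand is at least the average one. -/
theorem exists_frame_bound {E α : Type*} [NormedAddCommGroup E] [InnerProductSpace ℝ E]
    [FiniteDimensional ℝ E] [Nontrivial E] (T : Finset α) (v : α → E)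
    (hT : Submodule.span ℝ (v '' (T : Set α)) = ⊤) :
    ∃ c : ℝ, 0 < c ∧ ∀ u : E, ∃ a ∈ T, c * ‖u‖ ≤ |inner ℝ u (v a)| := by
  set f : E → ℝ := fun u => ∑ a ∈ T, |inner ℝ u (v a)| with hf
  have hfc : Continuous f := by
    refine continuous_finsetSum _ fun a _ => ?_
    fun_prop
  have hpos : ∀ u, u ≠ 0 → 0 < f u := by
    intro u hu
    refine (Finset.sum_nonneg fun a _ => abs_nonneg _).lt_of_ne fun h0 => hu ?_
    have h1 := (Finset.sum_eq_zero_iff_of_nonneg fun a _ => abs_nonneg _).1 h0.symm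
    have h2 : Submodule.span ℝ (v '' (T : Set α)) ≤ LinearMap.ker (innerₛₗ ℝ u) := by
      rw [Submodule.span_le]
      rintro _ ⟨a, ha, rfl⟩
      simpa using h1 a ha
    rw [hT] at h2
    have h3 := h2 (Submodule.mem_top (x := u))
    simpa using h3
  have hne : (Metric.sphere (0 : E) 1).Nonempty := NormedSpace.sphere_nonempty.2 zero_le_one
  obtain ⟨u₀, hu₀, hmin⟩ := (isCompact_sphere (0 : E) 1).exists_isMinOn hne hfc.continuousOn
  have hu₀' : u₀ ≠ 0 := by
    rintro rfl
    simp at hu₀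
  have hTne : T.Nonempty := by
    rw [Finset.nonempty_iff_ne_empty]
    rintro rfl
    simpa [hf] using hpos u₀ hu₀'
  have hcard : (0 : ℝ) < T.card := by exact_mod_cast hTne.card_pos
  refine ⟨f u₀ / T.card, div_pos (hpos _ hu₀') hcard, fun u => ?_⟩
  obtain ⟨a, ha, hmax⟩ := T.exists_max_image (fun a => |inner ℝ u (v a)|) hTne
  refine ⟨a, ha, ?_⟩
  have h1 : f u ≤ T.card * |inner ℝ u (v a)| := by
    simpa using Finset.sum_le_card_nsmul T _ _ hmax
  have h2 : f u₀ * ‖u‖ ≤ f u := by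
    rcases eq_or_ne u 0 with rfl | hu
    · simp [hf]
    · have hn : 0 < ‖u‖ := norm_pos_iff.2 hu
      have h3 : f u₀ ≤ f (‖u‖⁻¹ • u) := hmin (by simp [norm_smul, hn.ne'])
      have h4 : f (‖u‖⁻¹ • u) = ‖u‖⁻¹ * f u := by
        simp [hf, inner_smul_left, abs_mul, Finset.mul_sum]
      rw [h4, le_inv_mul_iff₀ hn] at h3
      linarith
  rw [div_mul_eq_mul_div, div_le_iff₀ hcard]
  linarith

variable {d : ℕ} {𝓜 : Measure ((Fin d → ℝ) × ℝ)}

theorem IsMaskLaw.ae_mem (h𝓜 : IsMaskLaw 𝓜) :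
    ∀ᵐ p ∂𝓜, (∀ k, p.1 k = 0 ∨ p.1 k = 1) ∧ p.2 ∈ Set.Icc (0 : ℝ) 1 := by
  filter_upwards [Measure.support_mem_ae (μ := 𝓜)] with p hp using h𝓜 hp

theorem finite_binary : {M : Fin d → ℝ | ∀ k, M k = 0 ∨ M k = 1}.Finite := by
  have h := Set.Finite.pi' (fun _ : Fin d => Set.toFinite ({0, 1} : Set ℝ))
  simpa using h

theorem measurable_signFlip (m : EuclideanSpace ℝ (Fin d)) : Measurable (signFlip m) := by
  unfold signFlip
  fun_prop

/-- T consists of the atoms of the mask law. As there are finitely many, τ and β can be chosen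
uniformly. -/
theorem exists_masks [IsProbabilityMeasure 𝓜] {m : EuclideanSpace ℝ (Fin d)} (hm : m ≠ 0)
    (h𝓜 : IsMaskLaw 𝓜) (hmask : MaskAssumption m 𝓜) :
    ∃ (T : Finset (Fin d → ℝ)) (τ β c : ℝ), 0 < τ ∧ 0 < β ∧ 0 < c ∧
      (∀ M ∈ T, ∀ k, M k = 0 ∨ M k = 1) ∧
      (∀ M ∈ T, β ≤ 𝓜.real {p | p.1 = M ∧ p.2 ∈ Set.Icc τ (1 - τ)}) ∧
      ∀ u, ∃ M ∈ T, c * ‖u‖ ≤ |inner ℝ u (signFlip m M)| := by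
  classical
  have : Nontrivial (EuclideanSpace ℝ (Fin d)) := ⟨m, 0, hm⟩
  have hfin : {M : Fin d → ℝ | (∀ k, M k = 0 ∨ M k = 1) ∧ 0 < 𝓜 {p | p.1 = M}}.Finite :=
    finite_binary.subset fun M hM => hM.1
  set T := hfin.toFinset with hT
  have hmem : ∀ M, M ∈ T ↔ (∀ k, M k = 0 ∨ M k = 1) ∧ 0 < 𝓜 {p | p.1 = M} := by simp [hT]
  have hTae : ∀ᵐ p ∂𝓜, p.1 ∈ T := by
    have h1 : 𝓜 (⋃ M ∈ {M : Fin d → ℝ | (∀ k, M k = 0 ∨ M k = 1) ∧ 𝓜 {p | p.1 = M} = 0},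
        {p | p.1 = M}) = 0 := by
      refine (measure_biUnion_null_iff ?_).2 fun M hM => hM.2
      exact (finite_binary.subset fun M hM => hM.1).countable
    have h2 := measure_eq_zero_iff_ae_notMem.1 h1
    filter_upwards [h𝓜.ae_mem, h2] with p hp hp2
    rw [hmem]
    refine ⟨hp.1, pos_iff_ne_zero.2 fun h0 => hp2 ?_⟩
    simp only [Set.mem_iUnion]
    exact ⟨p.1, ⟨hp.1, h0⟩, rfl⟩
  have hspan : Submodule.span ℝ (signFlip m '' (T : Set (Fin d → ℝ))) = ⊤ := by
    rw [eq_top_iff, ← hmask.1]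
    -- The image of the atoms is finite, hence closed, and has full measure, so it contains the
    -- support.
    refine Submodule.span_mono (Measure.support_subset_of_isClosed ?_ ?_)
    · exact (T.finite_toSet.image _).isClosed
    · have hms : MeasurableSet (signFlip m '' (T : Set (Fin d → ℝ))) :=
        (T.finite_toSet.image _).measurableSet
      refine (mem_ae_map_iff ((measurable_signFlip m).comp measurable_fst).aemeasurable hms).2 ?_
      filter_upwards [hTae] with p hp using ⟨p.1, hp, rfl⟩
  obtain ⟨c, hc, hframe⟩ := exists_frame_bound T (signFlip m) hspan
  have hTne : T.Nonempty := by
    obtain ⟨M, hM, -⟩ := hframe 0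
    exact ⟨M, hM⟩
  let τ : ℕ → ℝ := fun N => 1 / ((N : ℝ) + 1)
  have hτ0 : ∀ N, 0 < τ N := fun N => Nat.one_div_pos_of_nat
  have hτa : ∀ N N', N ≤ N' → τ N' ≤ τ N := fun N N' h => Nat.one_div_le_one_div h
  have hpos : ∀ M ∈ T, ∃ N : ℕ, 0 < 𝓜 {p | p.1 = M ∧ p.2 ∈ Set.Icc (τ N) (1 - τ N)} := by
    intro M hM
    have hsupp : M ∈ (𝓜.map Prod.fst).support := by
      rw [Measure.mem_support_iff_forall]
      intro U hU
      have h1 : 0 < (𝓜.map Prod.fst) {M} := by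
        rw [Measure.map_apply measurable_fst (measurableSet_singleton M)]
        exact ((hmem M).1 hM).2
      exact h1.trans_le (measure_mono (Set.singleton_subset_iff.2 (mem_of_mem_nhds hU)))
    have h2 := hmask.2 M hsupp
    by_contra hcon
    push Not at hcon
    refine h2.ne' ?_
    -- The ratios in (0, 1) are exhausted by the intervals [1/(N+1), 1 - 1/(N+1)]; if all of them
    -- were null given M, the ratio would almost surely be 0 or 1 where the mask is M.
    have h3 : 𝓜 (⋃ N : ℕ, {p | p.1 = M ∧ p.2 ∈ Set.Icc (τ N) (1 - τ N)}) = 0 :=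
      measure_iUnion_null fun N => le_antisymm (hcon N) zero_le
    have h4 := measure_eq_zero_iff_ae_notMem.1 h3
    rw [measure_eq_zero_iff_ae_notMem]
    filter_upwards [h𝓜.ae_mem, h4] with p hp hp4 hp5
    refine hp4 ?_
    simp only [Set.mem_insert_iff, Set.mem_singleton_iff, not_or] at hp5
    by_cases hpM : p.1 = M
    · simp only [hpM, Set.mem_singleton_iff, Set.indicator_of_mem, mul_one] at hp5
      have hl0 : 0 < p.2 := hp.2.1.lt_of_ne' hp5.1
      have hl1 : 0 < 1 - p.2 := sub_pos.2 (hp.2.2.lt_of_ne hp5.2)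
      obtain ⟨N, hN⟩ := exists_nat_one_div_lt (lt_min hl0 hl1)
      rw [lt_min_iff] at hN
      refine Set.mem_iUnion.2 ⟨N, hpM, hN.1.le, ?_⟩
      simp only [τ]
      linarith [hN.2]
    · simp [hpM] at hp5
  choose! N hN using hpos
  set K := T.sup N with hK
  set A : (Fin d → ℝ) → Set ((Fin d → ℝ) × ℝ) :=
    fun M => {p | p.1 = M ∧ p.2 ∈ Set.Icc (τ K) (1 - τ K)} with hA
  obtain ⟨M₀, hM₀, hmin⟩ := T.exists_min_image (fun M => 𝓜.real (A M)) hTne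
  refine ⟨T, τ K, 𝓜.real (A M₀), c, hτ0 K, ?_, hc, fun M hM => ((hmem M).1 hM).1, hmin, hframe⟩
  refine ENNReal.toReal_pos (ne_of_gt ((hN M₀ hM₀).trans_le (measure_mono ?_)))
    (measure_ne_top _ _)
  rintro p ⟨h1, h2, h3⟩
  have := hτa (N M₀) K (Finset.le_sup hM₀)
  exact ⟨h1, this.trans h2, h3.trans (by linarith)⟩

/-! ### Convex optimization with first-order inequalities -/

section Optimization

variable {d : ℕ} {f : EuclideanSpace ℝ (Fin d) → ℝ}
  {g : EuclideanSpace ℝ (Fin d) → EuclideanSpace ℝ (Fin d)} {B a α R : ℝ}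

theorem continuous_of_quadratic_bounds (hlow : ∀ v w, f w + inner ℝ (g w) (v - w) ≤ f v)
    (hup : ∀ v w, f v ≤ f w + inner ℝ (g w) (v - w) + B * ‖v - w‖ ^ 2) : Continuous f := by
  refine continuous_iff_continuousAt.2 fun w => ?_
  have h1 : Filter.Tendsto (fun v => f w + inner ℝ (g w) (v - w)) (nhds w) (nhds (f w)) := by
    have : Continuous fun v => f w + inner ℝ (g w) (v - w) := by fun_prop
    simpa using this.tendsto w
  have h2 : Filter.Tendsto (fun v => f w + inner ℝ (g w) (v - w) + B * ‖v - w‖ ^ 2) (nhds w)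
      (nhds (f w)) := by
    have : Continuous fun v => f w + inner ℝ (g w) (v - w) + B * ‖v - w‖ ^ 2 := by fun_prop
    simpa using this.tendsto w
  exact tendsto_of_tendsto_of_tendsto_of_le_of_le h1 h2 (fun v => hlow v w) fun v => hup v w

theorem norm_le_of_coercive (ha : 0 < a) (hcoer : ∀ w, a * ‖w‖ ≤ f w) (h0 : f 0 ≤ a * R)
    {w : EuclideanSpace ℝ (Fin d)} (hw : ∀ v, f w ≤ f v) : ‖w‖ ≤ R :=
  le_of_mul_le_mul_left ((hcoer w).trans ((hw 0).trans h0)) ha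

/-- Coercivity confines every minimizer to the ball of radius R, where compactness gives existence.
For uniqueness, strong convexity is used from the midpoint of two minimizers towards both: the
linear terms cancel. -/
theorem exists_isUniqueMinimizer (hf : Continuous f) (ha : 0 < a) (hcoer : ∀ w, a * ‖w‖ ≤ f w)
    (h0 : f 0 ≤ a * R) (hα : 0 < α)
    (hstrong : ∀ v w, ‖v‖ ≤ R → ‖w‖ ≤ R →
      f w + inner ℝ (g w) (v - w) + α / 2 * ‖v - w‖ ^ 2 ≤ f v) :
    ∃ w, IsUniqueMinimizer f w := by
  have hR : 0 ≤ R := by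
    have h1 := hcoer 0
    rw [norm_zero, mul_zero] at h1
    exact le_of_mul_le_mul_left (by linarith) ha
  obtain ⟨w, hwR, hmin⟩ := (isCompact_closedBall (0 : EuclideanSpace ℝ (Fin d)) R).exists_isMinOn
    ⟨0, by simpa using hR⟩ hf.continuousOn
  have hw : ∀ v, f w ≤ f v := by
    intro v
    by_cases hv : ‖v‖ ≤ R
    · exact hmin (by simpa using hv)
    · calc f w ≤ f 0 := hmin (by simpa using hR)
        _ ≤ a * R := h0
        _ ≤ a * ‖v‖ := by push Not at hv; gcongr
        _ ≤ f v := hcoer v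
  refine ⟨w, hw, fun u hu => ?_⟩
  have hwn := norm_le_of_coercive ha hcoer h0 hw
  have hun := norm_le_of_coercive ha hcoer h0 hu
  set c : EuclideanSpace ℝ (Fin d) := (1 / 2 : ℝ) • (u + w) with hc
  have hcn : ‖c‖ ≤ R := by
    rw [hc, norm_smul]
    have := norm_add_le u w
    norm_num
    linarith
  have h1 := hstrong u c hun hcn
  have h2 := hstrong w c hwn hcn
  have e1 : u - c = (1 / 2 : ℝ) • (u - w) := by rw [hc]; module
  have e2 : w - c = -((1 / 2 : ℝ) • (u - w)) := by rw [hc]; module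
  rw [e1] at h1
  rw [e2, inner_neg_right, norm_neg] at h2
  have h3 := hu c
  have h4 := hw c
  have h5 : ‖(1 / 2 : ℝ) • (u - w)‖ ^ 2 ≤ 0 := by
    have : α * ‖(1 / 2 : ℝ) • (u - w)‖ ^ 2 ≤ 0 := by linarith
    by_contra hneg
    push Not at hneg
    exact absurd this (not_le.2 (mul_pos hα hneg))
  have h6 : (1 / 2 : ℝ) • (u - w) = 0 := by
    rw [← norm_eq_zero]
    exact pow_eq_zero_iff two_ne_zero |>.1 (le_antisymm h5 (sq_nonneg _))
  rw [smul_eq_zero] at h6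
  exact sub_eq_zero.1 (h6.resolve_left (by norm_num))

/-- A gradient step of length 1/(2B) decreases f by at least ‖g w‖²/(4B). -/
theorem gradient_eq_zero_of_minimizer (hB : 0 < B)
    (hup : ∀ v w, f v ≤ f w + inner ℝ (g w) (v - w) + B * ‖v - w‖ ^ 2)
    {w : EuclideanSpace ℝ (Fin d)} (hw : ∀ v, f w ≤ f v) : g w = 0 := by
  have h1 := hup (w - (1 / (2 * B)) • g w) w
  have h2 := hw (w - (1 / (2 * B)) • g w)
  rw [sub_sub_cancel_left, inner_neg_right, norm_neg, inner_smul_right, norm_smul,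
    real_inner_self_eq_norm_sq, mul_pow, Real.norm_eq_abs, sq_abs] at h1
  have h3 : B * ((1 / (2 * B)) ^ 2 * ‖g w‖ ^ 2) = 1 / (4 * B) * ‖g w‖ ^ 2 := by
    field_simp; ring
  have h4 : 1 / (2 * B) * ‖g w‖ ^ 2 = 2 * (1 / (4 * B) * ‖g w‖ ^ 2) := by field_simp; ring
  have h5 : 1 / (4 * B) * ‖g w‖ ^ 2 ≤ 0 := by linarith
  have h6 : ‖g w‖ ^ 2 ≤ 0 := by
    by_contra hneg
    push Not at hneg
    exact absurd h5 (not_le.2 (by positivity))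
  exact norm_eq_zero.1 (pow_eq_zero_iff two_ne_zero |>.1 (le_antisymm h6 (sq_nonneg _)))

/-- The same step from 0 shows f 0 - f w ≥ ‖g 0‖²/(4B), while convexity bounds this gap by ‖g 0‖
‖w‖. The use is a lower bound of the norm of the minimizer. -/
theorem norm_gradient_zero_le (hB : 0 < B)
    (hlow : ∀ v w, f w + inner ℝ (g w) (v - w) ≤ f v)
    (hup : ∀ v w, f v ≤ f w + inner ℝ (g w) (v - w) + B * ‖v - w‖ ^ 2)
    {w : EuclideanSpace ℝ (Fin d)} (hw : ∀ v, f w ≤ f v) : ‖g 0‖ ≤ 4 * B * ‖w‖ := by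
  rcases eq_or_ne (g 0) 0 with h0 | h0
  · rw [h0, norm_zero]; positivity
  have hn : 0 < ‖g 0‖ := norm_pos_iff.2 h0
  have h1 := hup (-((1 / (2 * B)) • g 0)) 0
  have h2 := hw (-((1 / (2 * B)) • g 0))
  rw [sub_zero, inner_neg_right, norm_neg, inner_smul_right, norm_smul,
    real_inner_self_eq_norm_sq, mul_pow, Real.norm_eq_abs, sq_abs] at h1
  have h3 : B * ((1 / (2 * B)) ^ 2 * ‖g 0‖ ^ 2) = 1 / (4 * B) * ‖g 0‖ ^ 2 := by
    field_simp; ring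
  have h4 : 1 / (2 * B) * ‖g 0‖ ^ 2 = 2 * (1 / (4 * B) * ‖g 0‖ ^ 2) := by field_simp; ring
  have h5 := hlow w 0
  rw [sub_zero] at h5
  have h6 := abs_le.1 (abs_real_inner_le_norm (g 0) w)
  have h7 : 1 / (4 * B) * ‖g 0‖ ^ 2 ≤ ‖g 0‖ * ‖w‖ := by linarith
  have h8 : 1 / (4 * B) * ‖g 0‖ ^ 2 = ‖g 0‖ * (‖g 0‖ / (4 * B)) := by ring
  rw [h8] at h7
  have h9 := le_of_mul_le_mul_left h7 hn
  rw [div_le_iff₀ (by positivity)] at h9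
  linarith

/-- Since f v ≤ f w, the quadratic term is at most -⟨g w, v - w⟩. Here w need not be a minimizer of
f: it will be the minimizer of the expected loss, and f the empirical one. -/
theorem norm_sub_minimizer_le (hα : 0 < α)
    (hstrong : ∀ v w, ‖v‖ ≤ R → ‖w‖ ≤ R →
      f w + inner ℝ (g w) (v - w) + α / 2 * ‖v - w‖ ^ 2 ≤ f v)
    {v w : EuclideanSpace ℝ (Fin d)} (hvR : ‖v‖ ≤ R) (hwR : ‖w‖ ≤ R) (hv : ∀ u, f v ≤ f u) :
    ‖v - w‖ ≤ 2 * ‖g w‖ / α := by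
  have h1 := hstrong v w hvR hwR
  have h2 := hv w
  have h3 := abs_le.1 (abs_real_inner_le_norm (g w) (v - w))
  rw [le_div_iff₀ hα]
  rcases (norm_nonneg (v - w)).eq_or_lt with h0 | h0
  · rw [← h0, zero_mul]; positivity
  · have h4 : ‖v - w‖ * (α / 2 * ‖v - w‖) ≤ ‖v - w‖ * ‖g w‖ := by nlinarith
    have h5 := le_of_mul_le_mul_left h4 h0
    linarith

/-- From 2⟨v, u⟩ = ‖v‖² + ‖u‖² - ‖v - u‖² ≥ 2‖v‖‖u‖ - ‖v - u‖², together with ‖v‖ ≥ ‖u‖/2. -/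
theorem one_sub_le_cosSim {u v : EuclideanSpace ℝ (Fin d)} {ε : ℝ} (hu : u ≠ 0) (hε : 0 ≤ ε)
    (hε1 : ε ≤ 1) (h : ‖v - u‖ ≤ ε / 2 * ‖u‖) : 1 - ε ≤ cosSim v u := by
  have hun : 0 < ‖u‖ := norm_pos_iff.2 hu
  have h1 : ‖u‖ - ‖v - u‖ ≤ ‖v‖ := by
    have := norm_sub_norm_le u v
    rw [norm_sub_rev] at this
    linarith
  have hv2 : 1 / 2 * ‖u‖ ≤ ‖v‖ := by nlinarith
  have hvn : 0 < ‖v‖ := by linarith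
  rw [cosSim, le_div_iff₀ (by positivity)]
  have h2 := norm_sub_sq_real v u
  have h3 : ‖v - u‖ ^ 2 ≤ (ε / 2 * ‖u‖) ^ 2 := pow_le_pow_left₀ (norm_nonneg _) h 2
  have h4 : (ε / 2 * ‖u‖) ^ 2 ≤ ε * (‖v‖ * ‖u‖) := by
    have h5 : ε * (1 / 2 * ‖u‖ * ‖u‖) ≤ ε * (‖v‖ * ‖u‖) := by gcongr
    have h6 : (ε / 2 * ‖u‖) ^ 2 ≤ ε * (1 / 2 * ‖u‖ * ‖u‖) := by
      have : ε ^ 2 ≤ ε := by nlinarith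
      nlinarith [sq_nonneg ‖u‖, mul_le_mul_of_nonneg_right this (sq_nonneg ‖u‖), mul_nonneg hε (sq_nonneg ‖u‖)]
    linarith
  nlinarith [sq_nonneg (‖v‖ - ‖u‖), mul_nonneg hε (mul_nonneg hvn.le hun.le)]

end Optimization

/-! ### The empirical loss and its good samples -/

/-- Two labelled points and a mask with its ratio. -/
abbrev Triple (d : ℕ) : Type :=
  (EuclideanSpace ℝ (Fin d) × ℝ) × (EuclideanSpace ℝ (Fin d) × ℝ) × ((Fin d → ℝ) × ℝ)

section

variable {d n : ℕ}

/-- The mixed point of a triple. -/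
def triplePoint (t : Triple d) : EuclideanSpace ℝ (Fin d) := maskPoint t.2.2.1 t.1.1 t.2.1.1

/-- The mixed label of a triple. -/
def tripleLabel (t : Triple d) : ℝ := t.2.2.2 * t.1.2 + (1 - t.2.2.2) * t.2.1.2

/-- The loss of a triple. -/
def tripleLoss (w : EuclideanSpace ℝ (Fin d)) (t : Triple d) : ℝ :=
  pairLoss (tripleLabel t) (inner ℝ w (triplePoint t))

/-- The gradient in `w` of the loss of a triple. -/
def tripleGrad (w : EuclideanSpace ℝ (Fin d)) (t : Triple d) : EuclideanSpace ℝ (Fin d) :=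
  (Real.sigmoid (inner ℝ w (triplePoint t)) - tripleLabel t) • triplePoint t

/-- The triple of an ordered pair of indices. -/
def triple (ω : Sample d n) (p : Fin n × Fin n) : Triple d := (ω.1 p.1, ω.1 p.2, ω.2 p)

/-- The average over the ordered pairs of indices. -/
def pairMean {F : Type*} [AddCommMonoid F] [Module ℝ F] (f : Triple d → F) (ω : Sample d n) : F :=
  (1 / (n : ℝ) ^ 2) • ∑ p : Fin n × Fin n, f (triple ω p)

theorem maskLoss_eq (ω : Sample d n) (w : EuclideanSpace ℝ (Fin d)) :
    maskLoss ω w = pairMean (tripleLoss w) ω := by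
  rw [maskLoss, pairMean, Fintype.sum_prod_type, smul_eq_mul]
  rfl

theorem pairMean_mono {f g : Triple d → ℝ} {ω : Sample d n}
    (h : ∀ p, f (triple ω p) ≤ g (triple ω p)) : pairMean f ω ≤ pairMean g ω := by
  unfold pairMean
  simp only [smul_eq_mul]
  gcongr with p
  exact h p

theorem pairMean_add (f g : Triple d → ℝ) (ω : Sample d n) :
    pairMean (fun t => f t + g t) ω = pairMean f ω + pairMean g ω := by
  simp [pairMean, Finset.sum_add_distrib, mul_add]

theorem pairMean_mul_const (f : Triple d → ℝ) (c : ℝ) (ω : Sample d n) :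
    pairMean (fun t => f t * c) ω = pairMean f ω * c := by
  simp [pairMean, ← Finset.sum_mul, mul_assoc]

theorem pairMean_const [NeZero n] (c : ℝ) (ω : Sample d n) : pairMean (fun _ => c) ω = c := by
  have : (n : ℝ) ≠ 0 := by exact_mod_cast NeZero.ne n
  simp [pairMean]
  field_simp

/-- The gradient of the empirical masking loss. -/
def gradLoss (ω : Sample d n) (w : EuclideanSpace ℝ (Fin d)) : EuclideanSpace ℝ (Fin d) :=
  pairMean (tripleGrad w) ω

theorem inner_gradLoss (ω : Sample d n) (w u : EuclideanSpace ℝ (Fin d)) :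
    inner ℝ (gradLoss ω w) u = pairMean (fun t => inner ℝ (tripleGrad w t) u) ω := by
  simp [gradLoss, pairMean, inner_smul_left, sum_inner]

theorem inner_tripleGrad (w u : EuclideanSpace ℝ (Fin d)) (t : Triple d) :
    inner ℝ (tripleGrad w t) u =
      (Real.sigmoid (inner ℝ w (triplePoint t)) - tripleLabel t) * inner ℝ u (triplePoint t) := by
  rw [tripleGrad, real_inner_smul_left, real_inner_comm u]

theorem maskLoss_lower (ω : Sample d n) (v w : EuclideanSpace ℝ (Fin d)) :
    maskLoss ω w + inner ℝ (gradLoss ω w) (v - w) ≤ maskLoss ω v := by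
  rw [maskLoss_eq, maskLoss_eq, inner_gradLoss, ← pairMean_add]
  refine pairMean_mono fun p => ?_
  rw [inner_tripleGrad, inner_sub_left]
  exact pairLoss_lower _ _ _

theorem maskLoss_upper (ω : Sample d n) (v w : EuclideanSpace ℝ (Fin d)) :
    maskLoss ω v ≤ maskLoss ω w + inner ℝ (gradLoss ω w) (v - w) +
      1 / 2 * pairMean (fun t => ‖triplePoint t‖ ^ 2) ω * ‖v - w‖ ^ 2 := by
  rw [maskLoss_eq, maskLoss_eq, inner_gradLoss, ← pairMean_add, mul_comm (1 / 2 : ℝ), mul_assoc,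
    ← pairMean_mul_const, ← pairMean_add]
  refine pairMean_mono fun p => ?_
  rw [inner_tripleGrad]
  set x := triplePoint (triple ω p)
  have h := pairLoss_upper (tripleLabel (triple ω p)) (inner ℝ w x) (inner ℝ v x)
  rw [← inner_sub_left] at h
  refine h.trans ?_
  have h2 : (inner ℝ (v - w) x : ℝ) ^ 2 ≤ (‖v - w‖ * ‖x‖) ^ 2 :=
    sq_le_sq' (abs_le.1 (abs_real_inner_le_norm _ _)).1 (abs_le.1 (abs_real_inner_le_norm _ _)).2
  unfold tripleLoss
  nlinarith

/-- Triples whose points are close to the two class means, with mask `M` and a ratio bounded away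
from `0` and `1`. -/
def goodTriples (m : EuclideanSpace ℝ (Fin d)) (r τ : ℝ) (M : Fin d → ℝ) : Set (Triple d) :=
  {z | z.2 = 1 ∧ ‖z.1 - m‖ ≤ r} ×ˢ {z | z.2 = 0 ∧ ‖z.1 + m‖ ≤ r} ×ˢ
    {p | p.1 = M ∧ p.2 ∈ Set.Icc τ (1 - τ)}

/-- The labels are `0` or `1`, the mask is binary and the ratio lies in `[0, 1]`. -/
def IsRegularTriple (t : Triple d) : Prop :=
  (t.1.2 = 0 ∨ t.1.2 = 1) ∧ (t.2.1.2 = 0 ∨ t.2.1.2 = 1) ∧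
    (∀ k, t.2.2.1 k = 0 ∨ t.2.2.1 k = 1) ∧ t.2.2.2 ∈ Set.Icc (0 : ℝ) 1

theorem IsRegularTriple.label_mem {t : Triple d} (ht : IsRegularTriple t) :
    tripleLabel t ∈ Set.Icc (0 : ℝ) 1 := by
  obtain ⟨h1, h2, -, h3, h4⟩ := ht
  unfold tripleLabel
  rcases h1 with h1 | h1 <;> rcases h2 with h2 | h2 <;> rw [h1, h2] <;> constructor <;> linarith

theorem maskPoint_apply (M : Fin d → ℝ) (x x' : EuclideanSpace ℝ (Fin d)) (k : Fin d) :
    maskPoint M x x' k = M k * x k + (1 - M k) * x' k := rfl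

theorem norm_maskPoint_sq_le {M : Fin d → ℝ} (hM : ∀ k, M k = 0 ∨ M k = 1)
    (x x' : EuclideanSpace ℝ (Fin d)) : ‖maskPoint M x x'‖ ^ 2 ≤ ‖x‖ ^ 2 + ‖x'‖ ^ 2 := by
  rw [EuclideanSpace.norm_sq_eq, EuclideanSpace.norm_sq_eq, EuclideanSpace.norm_sq_eq,
    ← Finset.sum_add_distrib]
  refine Finset.sum_le_sum fun k _ => ?_
  rw [maskPoint_apply]
  rcases hM k with h | h <;> rw [h] <;> simp <;> positivity

theorem signFlip_eq_maskPoint (m : EuclideanSpace ℝ (Fin d)) (M : Fin d → ℝ) :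
    signFlip m M = maskPoint M m (-m) := by
  ext k
  rw [maskPoint_apply]
  simp [signFlip]
  ring

theorem maskPoint_sub (M : Fin d → ℝ) (x x' y y' : EuclideanSpace ℝ (Fin d)) :
    maskPoint M x x' - maskPoint M y y' = maskPoint M (x - y) (x' - y') := by
  ext k
  rw [PiLp.sub_apply, maskPoint_apply, maskPoint_apply, maskPoint_apply, PiLp.sub_apply,
    PiLp.sub_apply]
  ring

theorem norm_signFlip {M : Fin d → ℝ} (hM : ∀ k, M k = 0 ∨ M k = 1)
    (m : EuclideanSpace ℝ (Fin d)) : ‖signFlip m M‖ = ‖m‖ := by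
  rw [EuclideanSpace.norm_eq, EuclideanSpace.norm_eq]
  congr 1
  refine Finset.sum_congr rfl fun k _ => ?_
  rcases hM k with h | h <;> simp [signFlip, h]; norm_num

variable {m : EuclideanSpace ℝ (Fin d)} {r τ : ℝ} {M : Fin d → ℝ}

/-- The vector m ⊙ (2M - 1) is the masked point of m and -m, and masking with a binary mask does not
increase the joint Euclidean norm of the two errors. -/
theorem norm_triplePoint_sub_le (hr : 0 ≤ r) (hM : ∀ k, M k = 0 ∨ M k = 1) {t : Triple d}
    (ht : t ∈ goodTriples m r τ M) : ‖triplePoint t - signFlip m M‖ ≤ 2 * r := by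
  obtain ⟨⟨-, h1⟩, ⟨-, h2⟩, h3, -⟩ := ht
  rw [triplePoint, h3, signFlip_eq_maskPoint, maskPoint_sub, sub_neg_eq_add]
  refine abs_le_of_sq_le_sq' ((norm_maskPoint_sq_le hM _ _).trans ?_) (by positivity) |>.2
  have h4 := pow_le_pow_left₀ (norm_nonneg _) h1 2
  have h5 := pow_le_pow_left₀ (norm_nonneg _) h2 2
  nlinarith [sq_nonneg r]

theorem tripleLabel_mem_of_good {t : Triple d} (ht : t ∈ goodTriples m r τ M) :
    tripleLabel t ∈ Set.Icc τ (1 - τ) := by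
  obtain ⟨⟨h1, -⟩, ⟨h2, -⟩, -, h3⟩ := ht
  rw [tripleLabel, h1, h2]
  simpa using h3

/-- The sample is regular and, for every mask of `T`, the frequency of good triples is at
least `q`. -/
def IsGoodSample (m : EuclideanSpace ℝ (Fin d)) (r τ : ℝ) (T : Finset (Fin d → ℝ)) (q : ℝ)
    (ω : Sample d n) : Prop :=
  (∀ p, IsRegularTriple (triple ω p)) ∧
    ∀ M ∈ T, q ≤ pairMean ((goodTriples m r τ M).indicator 1) ω

variable {T : Finset (Fin d → ℝ)} {q c : ℝ} {ω : Sample d n}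

theorem half_mul_norm_le_abs_inner (hr : 0 ≤ r) (hrc : 4 * r ≤ c) (hM : ∀ k, M k = 0 ∨ M k = 1)
    {u : EuclideanSpace ℝ (Fin d)} (hu : c * ‖u‖ ≤ |inner ℝ u (signFlip m M)|) {t : Triple d}
    (ht : t ∈ goodTriples m r τ M) : c / 2 * ‖u‖ ≤ |inner ℝ u (triplePoint t)| := by
  have h1 := norm_triplePoint_sub_le hr hM ht
  have h2 : |inner ℝ u (signFlip m M)| - |inner ℝ u (triplePoint t)| ≤ ‖u‖ * (2 * r) := by
    calc |inner ℝ u (signFlip m M)| - |inner ℝ u (triplePoint t)|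
        ≤ |inner ℝ u (signFlip m M) - inner ℝ u (triplePoint t)| := abs_sub_abs_le_abs_sub _ _
      _ = |inner ℝ u (triplePoint t - signFlip m M)| := by rw [abs_sub_comm, inner_sub_right]
      _ ≤ ‖u‖ * ‖triplePoint t - signFlip m M‖ := abs_real_inner_le_norm _ _
      _ ≤ _ := by gcongr
  nlinarith [norm_nonneg u]

/-- For the mask that the frame bound assigns to w, each good triple costs at least τ(c/2)‖w‖, and
all other triples have nonnegative loss. -/
theorem IsGoodSample.coercive (hω : IsGoodSample m r τ T q ω) (hr : 0 ≤ r) (hrc : 4 * r ≤ c)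
    (hτ : 0 ≤ τ) (hT : ∀ M ∈ T, ∀ k, M k = 0 ∨ M k = 1)
    (hframe : ∀ u, ∃ M ∈ T, c * ‖u‖ ≤ |inner ℝ u (signFlip m M)|)
    (w : EuclideanSpace ℝ (Fin d)) : q * (τ * (c / 2)) * ‖w‖ ≤ maskLoss ω w := by
  obtain ⟨M, hMT, hM⟩ := hframe w
  have hc : 0 ≤ c := by linarith
  calc q * (τ * (c / 2)) * ‖w‖ = q * (τ * (c / 2 * ‖w‖)) := by ring
    _ ≤ pairMean ((goodTriples m r τ M).indicator 1) ω * (τ * (c / 2 * ‖w‖)) := by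
        gcongr
        exact hω.2 M hMT
    _ = pairMean (fun t => (goodTriples m r τ M).indicator 1 t * (τ * (c / 2 * ‖w‖))) ω :=
        (pairMean_mul_const _ _ _).symm
    _ ≤ pairMean (tripleLoss w) ω := by
        refine pairMean_mono fun p => ?_
        by_cases hp : triple ω p ∈ goodTriples m r τ M
        · rw [Set.indicator_of_mem hp, Pi.one_apply, one_mul]
          refine le_trans ?_ (mul_abs_le_pairLoss hτ (tripleLabel_mem_of_good hp) _)
          gcongr
          exact half_mul_norm_le_abs_inner hr hrc (hT M hMT) hM hp
        · rw [Set.indicator_of_notMem hp, zero_mul]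
          exact pairLoss_nonneg (hω.1 p).label_mem _
    _ = maskLoss ω w := (maskLoss_eq ω w).symm

/-- The frame bound is applied to v - w. Good triples have points of norm at most ‖m‖ + 2r, so their
predictions stay in the interval of the modulus; the other triples contribute plain convexity. -/
theorem IsGoodSample.strong (hω : IsGoodSample m r τ T q ω) (hr : 0 ≤ r) (hrc : 4 * r ≤ c)
    (hT : ∀ M ∈ T, ∀ k, M k = 0 ∨ M k = 1)
    (hframe : ∀ u, ∃ M ∈ T, c * ‖u‖ ≤ |inner ℝ u (signFlip m M)|) {R : ℝ}
    (v w : EuclideanSpace ℝ (Fin d)) (hv : ‖v‖ ≤ R) (hw : ‖w‖ ≤ R) :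
    maskLoss ω w + inner ℝ (gradLoss ω w) (v - w) +
      q * logisticModulus (R * (‖m‖ + 2 * r)) * (c / 2) ^ 2 / 2 * ‖v - w‖ ^ 2 ≤ maskLoss ω v := by
  obtain ⟨M, hMT, hM⟩ := hframe (v - w)
  have hc : 0 ≤ c := by linarith
  have hR : 0 ≤ R := (norm_nonneg v).trans hv
  set h := logisticModulus (R * (‖m‖ + 2 * r)) with hh
  have hpos : 0 < h := logisticModulus_pos _
  calc maskLoss ω w + inner ℝ (gradLoss ω w) (v - w) + q * h * (c / 2) ^ 2 / 2 * ‖v - w‖ ^ 2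
      = maskLoss ω w + inner ℝ (gradLoss ω w) (v - w) +
          q * (h / 2 * (c / 2 * ‖v - w‖) ^ 2) := by ring
    _ ≤ maskLoss ω w + inner ℝ (gradLoss ω w) (v - w) +
          pairMean ((goodTriples m r τ M).indicator 1) ω * (h / 2 * (c / 2 * ‖v - w‖) ^ 2) := by
        gcongr
        exact hω.2 M hMT
    _ = pairMean (fun t => tripleLoss w t + inner ℝ (tripleGrad w t) (v - w) +
          (goodTriples m r τ M).indicator 1 t * (h / 2 * (c / 2 * ‖v - w‖) ^ 2)) ω := by
        rw [pairMean_add, pairMean_add, pairMean_mul_const, maskLoss_eq, inner_gradLoss]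
    _ ≤ pairMean (tripleLoss v) ω := by
        refine pairMean_mono fun p => ?_
        rw [inner_tripleGrad, inner_sub_left]
        by_cases hp : triple ω p ∈ goodTriples m r τ M
        · rw [Set.indicator_of_mem hp, Pi.one_apply, one_mul]
          set x := triplePoint (triple ω p) with hx
          have hxn : ‖x‖ ≤ ‖m‖ + 2 * r := by
            have h1 := norm_triplePoint_sub_le hr (hT M hMT) hp
            have h2 := norm_signFlip (hT M hMT) m
            calc ‖x‖ = ‖signFlip m M + (x - signFlip m M)‖ := by congr 1; abel
              _ ≤ ‖signFlip m M‖ + ‖x - signFlip m M‖ := norm_add_le _ _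
              _ ≤ _ := by rw [h2]; gcongr
          have hb : ∀ u : EuclideanSpace ℝ (Fin d), ‖u‖ ≤ R →
              |inner ℝ u x| ≤ R * (‖m‖ + 2 * r) := fun u hu =>
            (abs_real_inner_le_norm _ _).trans (by gcongr)
          refine le_trans ?_ (pairLoss_strong_lower (tripleLabel (triple ω p)) (hb w hw) (hb v hv))
          have h3 := half_mul_norm_le_abs_inner hr hrc (hT M hMT) hM hp
          rw [inner_sub_left] at h3
          have h4 : (c / 2 * ‖v - w‖) ^ 2 ≤ (inner ℝ v x - inner ℝ w x) ^ 2 := by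
            rw [← sq_abs (inner ℝ v x - inner ℝ w x : ℝ)]
            exact pow_le_pow_left₀ (by positivity) h3 2
          unfold tripleLoss
          gcongr
        · rw [Set.indicator_of_notMem hp, zero_mul, add_zero]
          exact pairLoss_lower _ _ _
    _ = maskLoss ω v := (maskLoss_eq ω v).symm

theorem maskLoss_zero [NeZero n] (ω : Sample d n) : maskLoss ω 0 = Real.log 2 := by
  rw [maskLoss_eq]
  have : tripleLoss (0 : EuclideanSpace ℝ (Fin d)) = fun _ => Real.log 2 := by
    ext t
    simp [tripleLoss, pairLoss_zero]
  rw [this, pairMean_const]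

end

/-! ### Measurability and averages over pairs -/

section Measurability

variable {d n : ℕ}

@[fun_prop]
theorem measurable_triple (p : Fin n × Fin n) : Measurable fun ω : Sample d n => triple ω p := by
  unfold triple
  fun_prop

@[fun_prop]
theorem measurable_triplePoint : Measurable (triplePoint (d := d)) := by
  unfold triplePoint maskPoint
  fun_prop

@[fun_prop]
theorem measurable_tripleLabel : Measurable (tripleLabel (d := d)) := by
  unfold tripleLabel
  fun_prop

theorem measurable_tripleLoss (w : EuclideanSpace ℝ (Fin d)) : Measurable (tripleLoss w) :=
  continuous_pairLoss.measurable.comp (f := fun t => (tripleLabel t, inner ℝ w (triplePoint t)))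
    (measurable_tripleLabel.prodMk (by fun_prop))

theorem measurable_tripleGrad (w : EuclideanSpace ℝ (Fin d)) : Measurable (tripleGrad w) := by
  have h : Measurable fun t : Triple d => Real.sigmoid (inner ℝ w (triplePoint t)) :=
    continuous_sigmoid.measurable.comp (by fun_prop)
  unfold tripleGrad
  fun_prop

theorem measurableSet_goodTriples (m : EuclideanSpace ℝ (Fin d)) (r τ : ℝ) (M : Fin d → ℝ) :
    MeasurableSet (goodTriples m r τ M) := by
  refine MeasurableSet.prod ?_ (MeasurableSet.prod ?_ ?_)
  · exact .inter (measurableSet_eq_fun measurable_snd measurable_const) <|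
      measurableSet_le (f := fun z : EuclideanSpace ℝ (Fin d) × ℝ => ‖z.1 - m‖) (by fun_prop)
        measurable_const
  · exact .inter (measurableSet_eq_fun measurable_snd measurable_const) <|
      measurableSet_le (f := fun z : EuclideanSpace ℝ (Fin d) × ℝ => ‖z.1 + m‖) (by fun_prop)
        measurable_const
  · exact (measurable_fst (measurableSet_singleton M)).inter (measurable_snd measurableSet_Icc)

end Measurability

section PairMean

variable {d n : ℕ} {P : Measure (Sample d n)} {F : Type*} [NormedAddCommGroup F] [NormedSpace ℝ F]
  {f : Triple d → F}

theorem integrable_pairMean (hf : ∀ p, Integrable (fun ω => f (triple ω p)) P) :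
    Integrable (pairMean f) P := by
  unfold pairMean
  exact (integrable_finsetSum _ fun p _ => hf p).smul _

theorem integral_pairMean (hf : ∀ p, Integrable (fun ω => f (triple ω p)) P) :
    ∫ ω, pairMean f ω ∂P =
      (1 / (n : ℝ) ^ 2) • ∑ p : Fin n × Fin n, ∫ ω, f (triple ω p) ∂P := by
  unfold pairMean
  rw [integral_smul, integral_finsetSum _ fun p _ => hf p]

theorem average_le [NeZero n] {g : Fin n × Fin n → ℝ} {c : ℝ} (h : ∀ p, g p ≤ c) :
    (1 / (n : ℝ) ^ 2) • ∑ p, g p ≤ c := by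
  have hn : (0 : ℝ) < n := by exact_mod_cast Nat.pos_of_ne_zero (NeZero.ne n)
  rw [smul_eq_mul, one_div, inv_mul_le_iff₀ (by positivity)]
  refine (Finset.sum_le_card_nsmul Finset.univ g c fun p _ => h p).trans (le_of_eq ?_)
  simp [sq]

end PairMean

/-! ### The expected loss and its gradient -/

section Expectation

variable {d n : ℕ} {m : EuclideanSpace ℝ (Fin d)} {S : Matrix (Fin d) (Fin d) ℝ} {κ : ℝ}
  {𝓜 : Measure ((Fin d → ℝ) × ℝ)} [IsProbabilityMeasure 𝓜]

instance : IsProbabilityMeasure (sampleLaw m S 𝓜 κ n) :=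
  inferInstanceAs (IsProbabilityMeasure (pairLaw (dataDist m S κ) 𝓜 n))

theorem ae_isRegularTriple (h𝓜 : IsMaskLaw 𝓜) :
    ∀ᵐ ω ∂(sampleLaw m S 𝓜 κ n), ∀ p, IsRegularTriple (triple ω p) := by
  rw [ae_all_iff]
  intro p
  have h1 := fun i => (measurePreserving_point (ν := dataDist m S κ) (μ := 𝓜) (n := n)
    i).quasiMeasurePreserving.ae ae_dataDist_label
  have h2 := (measurePreserving_mark (ν := dataDist m S κ) (μ := 𝓜) (n := n)
    p).quasiMeasurePreserving.ae h𝓜.ae_mem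
  filter_upwards [h1 p.1, h1 p.2, h2] with ω a b c using ⟨a, b, c.1, c.2⟩

/-- A bound of the exponential moments of the coordinates of the data points. -/
def momentBound (m : EuclideanSpace ℝ (Fin d)) (S : Matrix (Fin d) (Fin d) ℝ) : ℝ :=
  2 * Real.exp (2 * ‖m‖ + 2 * S.trace)

theorem momentBound_pos (m : EuclideanSpace ℝ (Fin d)) (S : Matrix (Fin d) (Fin d) ℝ) :
    0 < momentBound m S := by
  unfold momentBound
  positivity

theorem IsRegularTriple.abs_point_le {t : Triple d} (ht : IsRegularTriple t) (k : Fin d) :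
    |triplePoint t k| ≤ |t.1.1 k| + |t.2.1.1 k| := by
  rw [triplePoint, maskPoint_apply]
  rcases ht.2.2.1 k with h | h <;> simp [h]

theorem IsRegularTriple.abs_sigmoid_sub_label_le {t : Triple d} (ht : IsRegularTriple t) (x : ℝ) :
    |Real.sigmoid x - tripleLabel t| ≤ 1 := by
  have h1 := ht.label_mem
  have h2 := Real.sigmoid_nonneg x
  have h3 := Real.sigmoid_le_one x
  rw [abs_le]
  constructor <;> linarith [h1.1, h1.2]

theorem IsRegularTriple.norm_grad_le {t : Triple d} (ht : IsRegularTriple t)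
    (w : EuclideanSpace ℝ (Fin d)) : ‖tripleGrad w t‖ ≤ ‖triplePoint t‖ := by
  rw [tripleGrad, norm_smul, Real.norm_eq_abs]
  exact mul_le_of_le_one_left (norm_nonneg _) (ht.abs_sigmoid_sub_label_le _)

theorem IsRegularTriple.abs_grad_le {t : Triple d} (ht : IsRegularTriple t)
    (w : EuclideanSpace ℝ (Fin d)) (k : Fin d) :
    |tripleGrad w t k| ≤ |t.1.1 k| + |t.2.1.1 k| := by
  rw [tripleGrad, PiLp.smul_apply, smul_eq_mul, abs_mul]
  exact (mul_le_of_le_one_left (abs_nonneg _) (ht.abs_sigmoid_sub_label_le _)).trans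
    (ht.abs_point_le k)

section Moments

variable (hS : S.PosSemidef) (hκ : 1 ≤ κ)
include hS hκ

theorem integrable_exp_two_abs_sample (i : Fin n) (k : Fin d) :
    Integrable (fun ω => Real.exp (2 * |(ω.1 i).1 k|)) (sampleLaw m S 𝓜 κ n) :=
  (measurePreserving_point (ν := dataDist m S κ) (μ := 𝓜) i).integrable_comp_of_integrable
    (integrable_exp_two_abs_dataDist hS hκ k)

theorem integral_exp_two_abs_sample_le (i : Fin n) (k : Fin d) :
    ∫ ω, Real.exp (2 * |(ω.1 i).1 k|) ∂(sampleLaw m S 𝓜 κ n) ≤ momentBound m S := by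
  have hmp := measurePreserving_point (ν := dataDist m S κ) (μ := 𝓜) i
  have h := integral_map (μ := pairLaw (dataDist m S κ) 𝓜 n) hmp.measurable.aemeasurable
    (f := fun z : EuclideanSpace ℝ (Fin d) × ℝ => Real.exp (2 * |z.1 k|))
    (by fun_prop)
  rw [hmp.map_eq] at h
  exact h.symm.le.trans (integral_exp_two_abs_dataDist_le hS hκ k)

variable (h𝓜 : IsMaskLaw 𝓜)
include h𝓜

/-- By e^(a+b) ≤ (e^(2a) + e^(2b))/2, only the law of single points enters, so diagonal pairs need
no separate treatment. -/
theorem exp_abs_triple {f : Triple d → ℝ} (hf : Measurable f) {k : Fin d}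
    (hfk : ∀ t, IsRegularTriple t → |f t| ≤ |t.1.1 k| + |t.2.1.1 k|) (p : Fin n × Fin n) :
    Integrable (fun ω => Real.exp |f (triple ω p)|) (sampleLaw m S 𝓜 κ n) ∧
    ∫ ω, Real.exp |f (triple ω p)| ∂(sampleLaw m S 𝓜 κ n) ≤ momentBound m S := by
  have h1 := integrable_exp_two_abs_sample (m := m) (𝓜 := 𝓜) hS hκ p.1 k
  have h2 := integrable_exp_two_abs_sample (m := m) (𝓜 := 𝓜) hS hκ p.2 k
  have h12 := (h1.add h2).const_mul (1 / 2)
  have hb : ∀ᵐ ω ∂(sampleLaw m S 𝓜 κ n), Real.exp |f (triple ω p)| ≤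
      1 / 2 * (Real.exp (2 * |(ω.1 p.1).1 k|) + Real.exp (2 * |(ω.1 p.2).1 k|)) := by
    filter_upwards [ae_isRegularTriple h𝓜] with ω hω
    have h3 := hfk _ (hω p)
    set a := |(ω.1 p.1).1 k|
    set b := |(ω.1 p.2).1 k|
    have h4 : Real.exp |f (triple ω p)| ≤ Real.exp a * Real.exp b := by
      rw [← Real.exp_add]
      exact Real.exp_le_exp.2 h3
    have h5 : Real.exp (2 * a) = Real.exp a ^ 2 := by rw [← Real.exp_nat_mul]; norm_num
    have h6 : Real.exp (2 * b) = Real.exp b ^ 2 := by rw [← Real.exp_nat_mul]; norm_num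
    rw [h5, h6]
    nlinarith [sq_nonneg (Real.exp a - Real.exp b)]
  have hI : Integrable (fun ω => Real.exp |f (triple ω p)|) (sampleLaw m S 𝓜 κ n) := by
    refine h12.mono ?_ ?_
    · exact (Real.measurable_exp.comp
        (hf.comp (measurable_triple p)).abs).aestronglyMeasurable
    · filter_upwards [hb] with ω hω
      rw [Real.norm_eq_abs, Real.norm_eq_abs, abs_of_pos (Real.exp_pos _)]
      exact hω.trans (le_abs_self _)
  refine ⟨hI, (integral_mono_ae hI h12 hb).trans ?_⟩
  have h7 := integral_exp_two_abs_sample_le (m := m) (𝓜 := 𝓜) hS hκ p.1 k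
  have h8 := integral_exp_two_abs_sample_le (m := m) (𝓜 := 𝓜) hS hκ p.2 k
  rw [integral_const_mul]
  simp only [Pi.add_apply]
  rw [integral_add h1 h2]
  linarith

theorem norm_sq_triplePoint (p : Fin n × Fin n) :
    Integrable (fun ω => ‖triplePoint (triple ω p)‖ ^ 2) (sampleLaw m S 𝓜 κ n) ∧
    ∫ ω, ‖triplePoint (triple ω p)‖ ^ 2 ∂(sampleLaw m S 𝓜 κ n) ≤ 2 * (d * momentBound m S) := by
  have h1 := fun i k => integrable_exp_two_abs_sample (m := m) (𝓜 := 𝓜) (n := n) hS hκ i k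
  have hsum : ∀ k, Integrable (fun ω : Sample d n => Real.exp (2 * |(ω.1 p.1).1 k|) +
      Real.exp (2 * |(ω.1 p.2).1 k|)) (sampleLaw m S 𝓜 κ n) :=
    fun k => (h1 p.1 k).add (h1 p.2 k)
  have h2 : Integrable (fun ω : Sample d n => ∑ k : Fin d, (Real.exp (2 * |(ω.1 p.1).1 k|) +
      Real.exp (2 * |(ω.1 p.2).1 k|))) (sampleLaw m S 𝓜 κ n) :=
    integrable_finsetSum _ fun k _ => hsum k
  have hx : ∀ x : ℝ, x ^ 2 ≤ Real.exp (2 * |x|) := fun x => by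
    have := Real.quadratic_le_exp_of_nonneg (by positivity : 0 ≤ 2 * |x|)
    nlinarith [sq_abs x, abs_nonneg x]
  have hb : ∀ᵐ ω ∂(sampleLaw m S 𝓜 κ n), ‖triplePoint (triple ω p)‖ ^ 2 ≤
      ∑ k : Fin d, (Real.exp (2 * |(ω.1 p.1).1 k|) + Real.exp (2 * |(ω.1 p.2).1 k|)) := by
    filter_upwards [ae_isRegularTriple h𝓜] with ω hω
    refine (norm_maskPoint_sq_le (hω p).2.2.1 _ _).trans ?_
    rw [EuclideanSpace.norm_sq_eq, EuclideanSpace.norm_sq_eq, ← Finset.sum_add_distrib]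
    refine Finset.sum_le_sum fun k _ => ?_
    rw [Real.norm_eq_abs, Real.norm_eq_abs, sq_abs, sq_abs]
    exact add_le_add (hx _) (hx _)
  have hI : Integrable (fun ω => ‖triplePoint (triple ω p)‖ ^ 2) (sampleLaw m S 𝓜 κ n) := by
    refine h2.mono (Measurable.aestronglyMeasurable (by fun_prop)) ?_
    filter_upwards [hb] with ω hω
    rw [Real.norm_eq_abs, Real.norm_eq_abs, abs_of_nonneg (sq_nonneg _)]
    exact hω.trans (le_abs_self _)
  refine ⟨hI, (integral_mono_ae hI h2 hb).trans ?_⟩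
  rw [integral_finsetSum _ fun k _ => hsum k]
  calc ∑ k : Fin d, ∫ ω, (Real.exp (2 * |(ω.1 p.1).1 k|) + Real.exp (2 * |(ω.1 p.2).1 k|))
        ∂(sampleLaw m S 𝓜 κ n) ≤ ∑ _k : Fin d, (momentBound m S + momentBound m S) := by
        refine Finset.sum_le_sum fun k _ => ?_
        rw [integral_add (h1 p.1 k) (h1 p.2 k)]
        exact add_le_add (integral_exp_two_abs_sample_le hS hκ p.1 k)
          (integral_exp_two_abs_sample_le hS hκ p.2 k)
    _ = _ := by simp; ring

theorem integrable_norm_triplePoint (p : Fin n × Fin n) :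
    Integrable (fun ω => ‖triplePoint (triple ω p)‖) (sampleLaw m S 𝓜 κ n) := by
  refine ((norm_sq_triplePoint (m := m) hS hκ h𝓜 p).1.add (integrable_const 1)).mono
    (Measurable.aestronglyMeasurable (by fun_prop)) (ae_of_all _ fun ω => ?_)
  rw [norm_norm, Real.norm_eq_abs]
  refine le_trans ?_ (le_abs_self _)
  simp only [Pi.add_apply]
  nlinarith [sq_nonneg (‖triplePoint (triple ω p)‖ - 1), norm_nonneg (triplePoint (triple ω p))]

theorem integrable_tripleLoss (w : EuclideanSpace ℝ (Fin d)) (p : Fin n × Fin n) :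
    Integrable (fun ω => tripleLoss w (triple ω p)) (sampleLaw m S 𝓜 κ n) := by
  have h := ((integrable_norm_triplePoint (m := m) hS hκ h𝓜 p).const_mul ‖w‖).add
    (integrable_const (Real.log 2))
  refine h.mono ((measurable_tripleLoss w).comp (measurable_triple p)).aestronglyMeasurable ?_
  filter_upwards [ae_isRegularTriple h𝓜] with ω hω
  rw [Real.norm_eq_abs, Real.norm_eq_abs]
  refine le_trans (abs_pairLoss_le (hω p).label_mem _) (le_trans ?_ (le_abs_self _))
  simp only [Pi.add_apply]
  linarith [abs_real_inner_le_norm w (triplePoint (triple ω p))]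

theorem integrable_maskLoss (w : EuclideanSpace ℝ (Fin d)) :
    Integrable (fun ω => maskLoss ω w) (sampleLaw m S 𝓜 κ n) := by
  simp_rw [maskLoss_eq]
  exact integrable_pairMean fun p => integrable_tripleLoss hS hκ h𝓜 w p

theorem integrable_tripleGrad (w : EuclideanSpace ℝ (Fin d)) (p : Fin n × Fin n) :
    Integrable (fun ω => tripleGrad w (triple ω p)) (sampleLaw m S 𝓜 κ n) := by
  refine (integrable_norm_triplePoint (m := m) hS hκ h𝓜 p).mono
    ((measurable_tripleGrad w).comp (measurable_triple p)).aestronglyMeasurable ?_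
  filter_upwards [ae_isRegularTriple h𝓜] with ω hω
  rw [norm_norm]
  exact (hω p).norm_grad_le w

theorem integrable_gradLoss (w : EuclideanSpace ℝ (Fin d)) :
    Integrable (fun ω => gradLoss ω w) (sampleLaw m S 𝓜 κ n) :=
  integrable_pairMean fun p => integrable_tripleGrad hS hκ h𝓜 w p

end Moments

/-- The expected gradient of the masking loss. -/
def expectedGrad (m : EuclideanSpace ℝ (Fin d)) (S : Matrix (Fin d) (Fin d) ℝ)
    (𝓜 : Measure ((Fin d → ℝ) × ℝ)) (κ : ℝ) (n : ℕ) (w : EuclideanSpace ℝ (Fin d)) :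
    EuclideanSpace ℝ (Fin d) :=
  ∫ ω, gradLoss ω w ∂(sampleLaw m S 𝓜 κ n)

section Bounds

variable (hS : S.PosSemidef) (hκ : 1 ≤ κ) (h𝓜 : IsMaskLaw 𝓜)
include hS hκ h𝓜

theorem inner_expectedGrad (w u : EuclideanSpace ℝ (Fin d)) :
    inner ℝ (expectedGrad m S 𝓜 κ n w) u =
      ∫ ω, inner ℝ (gradLoss ω w) u ∂(sampleLaw m S 𝓜 κ n) := by
  rw [expectedGrad, real_inner_comm, ← integral_inner (integrable_gradLoss hS hκ h𝓜 w)]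
  simp_rw [real_inner_comm u]

theorem integrable_linearization (v w : EuclideanSpace ℝ (Fin d)) :
    Integrable (fun ω => maskLoss ω w + inner ℝ (gradLoss ω w) (v - w)) (sampleLaw m S 𝓜 κ n) :=
  (integrable_maskLoss hS hκ h𝓜 w).add ((integrable_gradLoss hS hκ h𝓜 w).inner_const _)

theorem integral_linearization (v w : EuclideanSpace ℝ (Fin d)) :
    ∫ ω, (maskLoss ω w + inner ℝ (gradLoss ω w) (v - w)) ∂(sampleLaw m S 𝓜 κ n) =
      expectedMaskLoss m S 𝓜 κ n w + inner ℝ (expectedGrad m S 𝓜 κ n w) (v - w) := by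
  rw [integral_add (integrable_maskLoss hS hκ h𝓜 w)
    ((integrable_gradLoss hS hκ h𝓜 w).inner_const _), inner_expectedGrad hS hκ h𝓜]
  rfl

theorem expectedMaskLoss_lower (v w : EuclideanSpace ℝ (Fin d)) :
    expectedMaskLoss m S 𝓜 κ n w + inner ℝ (expectedGrad m S 𝓜 κ n w) (v - w) ≤
      expectedMaskLoss m S 𝓜 κ n v := by
  rw [← integral_linearization hS hκ h𝓜]
  exact integral_mono (integrable_linearization hS hκ h𝓜 v w) (integrable_maskLoss hS hκ h𝓜 v)
    fun ω => maskLoss_lower ω v w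

/-- The summand 1 keeps the smoothness constant positive without assuming d > 0. -/
theorem expectedMaskLoss_upper [NeZero n] (v w : EuclideanSpace ℝ (Fin d)) :
    expectedMaskLoss m S 𝓜 κ n v ≤
      expectedMaskLoss m S 𝓜 κ n w + inner ℝ (expectedGrad m S 𝓜 κ n w) (v - w) +
        (d * momentBound m S + 1) * ‖v - w‖ ^ 2 := by
  have h1 := fun p => norm_sq_triplePoint (m := m) (n := n) hS hκ h𝓜 p
  have h2 : Integrable (pairMean fun t => ‖triplePoint t‖ ^ 2) (sampleLaw m S 𝓜 κ n) :=
    integrable_pairMean fun p => (h1 p).1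
  have h3 : ∫ ω, pairMean (fun t => ‖triplePoint t‖ ^ 2) ω ∂(sampleLaw m S 𝓜 κ n) ≤
      2 * (d * momentBound m S) := by
    rw [integral_pairMean fun p => (h1 p).1]
    exact average_le fun p => (h1 p).2
  have h4 : Integrable (fun ω => 1 / 2 * pairMean (fun t => ‖triplePoint t‖ ^ 2) ω * ‖v - w‖ ^ 2)
      (sampleLaw m S 𝓜 κ n) := (h2.const_mul _).mul_const _
  have h5 := integral_mono (integrable_maskLoss hS hκ h𝓜 v)
    ((integrable_linearization hS hκ h𝓜 v w).add h4) fun ω => maskLoss_upper ω v w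
  simp only [Pi.add_apply] at h5
  rw [integral_add (integrable_linearization hS hκ h𝓜 v w) h4, integral_linearization hS hκ h𝓜,
    integral_mul_const, integral_const_mul] at h5
  refine h5.trans ?_
  gcongr
  linarith

omit [IsProbabilityMeasure 𝓜] hS hκ h𝓜 in
theorem half_mul_le_integral {Ω : Type*} {mΩ : MeasurableSpace Ω} {P : Measure Ω}
    [IsProbabilityMeasure P] {f : Ω → ℝ} (hf : Integrable f P) (hf0 : 0 ≤ᵐ[P] f) {A : Set Ω}
    (hA : MeasurableSet A) (hPA : 1 / 2 ≤ P.real A) {b : ℝ} (hb : 0 ≤ b)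
    (hfA : ∀ ω ∈ A, b ≤ f ω) : b / 2 ≤ ∫ ω, f ω ∂P := by
  have h1 : ∫ ω, A.indicator (fun _ => b) ω ∂P ≤ ∫ ω, f ω ∂P := by
    refine integral_mono_ae ((integrable_const b).indicator hA) hf ?_
    filter_upwards [hf0] with ω hω
    by_cases h : ω ∈ A
    · rw [Set.indicator_of_mem h]; exact hfA ω h
    · rw [Set.indicator_of_notMem h]; exact hω
  rw [integral_indicator_const _ hA, smul_eq_mul] at h1
  nlinarith

theorem expectedMaskLoss_coercive {A : Set (Sample d n)} (hA : MeasurableSet A)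
    (hPA : 1 / 2 ≤ (sampleLaw m S 𝓜 κ n).real A) {a : ℝ} (ha : 0 ≤ a)
    (w : EuclideanSpace ℝ (Fin d)) (h : ∀ ω ∈ A, a * ‖w‖ ≤ maskLoss ω w) :
    a / 2 * ‖w‖ ≤ expectedMaskLoss m S 𝓜 κ n w := by
  have h1 : 0 ≤ᵐ[sampleLaw m S 𝓜 κ n] fun ω => maskLoss ω w := by
    filter_upwards [ae_isRegularTriple h𝓜] with ω hω
    rw [maskLoss_eq]
    simp only [pairMean, smul_eq_mul, Pi.zero_apply]
    have := Finset.sum_nonneg fun p (_ : p ∈ Finset.univ) =>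
      pairLoss_nonneg (hω p).label_mem (inner ℝ w (triplePoint (triple ω p)))
    exact mul_nonneg (by positivity) this
  have h2 := half_mul_le_integral (integrable_maskLoss hS hκ h𝓜 w) h1 hA hPA (by positivity) h
  unfold expectedMaskLoss
  linarith

/-- The gap between the loss and its linearization is nonnegative everywhere and quadratic on A, so
integration loses only the factor P(A) ≥ 1/2. -/
theorem expectedMaskLoss_strong {A : Set (Sample d n)} (hA : MeasurableSet A)
    (hPA : 1 / 2 ≤ (sampleLaw m S 𝓜 κ n).real A) {α : ℝ} (hα : 0 ≤ α)
    (v w : EuclideanSpace ℝ (Fin d))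
    (h : ∀ ω ∈ A, maskLoss ω w + inner ℝ (gradLoss ω w) (v - w) + α / 2 * ‖v - w‖ ^ 2 ≤
      maskLoss ω v) :
    expectedMaskLoss m S 𝓜 κ n w + inner ℝ (expectedGrad m S 𝓜 κ n w) (v - w) +
      α / 2 / 2 * ‖v - w‖ ^ 2 ≤ expectedMaskLoss m S 𝓜 κ n v := by
  have h2 := half_mul_le_integral (b := α / 2 * ‖v - w‖ ^ 2)
    ((integrable_maskLoss hS hκ h𝓜 v).sub (integrable_linearization hS hκ h𝓜 v w))
    (ae_of_all _ fun ω => sub_nonneg.2 (maskLoss_lower ω v w)) hA hPA (by positivity)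
    fun ω hω => le_sub_iff_add_le'.2 (h ω hω)
  simp only [Pi.sub_apply] at h2
  rw [integral_sub (integrable_maskLoss hS hκ h𝓜 v) (integrable_linearization hS hκ h𝓜 v w),
    integral_linearization hS hκ h𝓜] at h2
  change _ ≤ expectedMaskLoss m S 𝓜 κ n v - _ at h2
  linarith

end Bounds

end Expectation

/-! ### Integrals over off-diagonal pairs -/

section Product

variable {Z W : Type} [MeasurableSpace Z] [MeasurableSpace W] {ν : Measure Z} {μ : Measure W}
  [IsProbabilityMeasure ν] [IsProbabilityMeasure μ] {n : ℕ} {a b : Z → ℝ} {c : W → ℝ}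
  {p : Fin n × Fin n}

theorem integral_mul_pair (hp : p.1 ≠ p.2) (ha : Measurable a) (hb : Measurable b)
    (hc : Measurable c) (hai : Integrable a ν) (hbi : Integrable b ν) (hci : Integrable c μ) :
    Integrable (fun ω => a (ω.1 p.1) * b (ω.1 p.2) * c (ω.2 p)) (pairLaw ν μ n) ∧
    ∫ ω, a (ω.1 p.1) * b (ω.1 p.2) * c (ω.2 p) ∂(pairLaw ν μ n) =
      (∫ z, a z ∂ν) * (∫ z, b z ∂ν) * ∫ x, c x ∂μ := by
  have h := iIndepFun_coord (ν := ν) (μ := μ) (n := n)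
  have h1 : IndepFun (fun ω : (Fin n → Z) × (Fin n × Fin n → W) => a (ω.1 p.1))
      (fun ω => b (ω.1 p.2)) (pairLaw ν μ n) :=
    (h.indepFun (i := Sum.inl p.1) (j := Sum.inl p.2) (by simpa using hp)).comp
      (φ := a) (ψ := b) ha hb
  have h2 : IndepFun (fun ω : (Fin n → Z) × (Fin n × Fin n → W) => a (ω.1 p.1) * b (ω.1 p.2))
      (fun ω => c (ω.2 p)) (pairLaw ν μ n) :=
    (h.indepFun_prodMk measurable_coord (Sum.inl p.1) (Sum.inl p.2) (Sum.inr p)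
      (by simp) (by simp)).comp (φ := fun z : Z × Z => a z.1 * b z.2) (ψ := c)
      ((ha.comp measurable_fst).mul (hb.comp measurable_snd)) hc
  have hm1 := measurePreserving_point (ν := ν) (μ := μ) p.1
  have hm2 := measurePreserving_point (ν := ν) (μ := μ) p.2
  have hm3 := measurePreserving_mark (ν := ν) (μ := μ) p
  have i1 : Integrable (fun ω : (Fin n → Z) × (Fin n × Fin n → W) => a (ω.1 p.1)) (pairLaw ν μ n) :=
    hm1.integrable_comp_of_integrable hai
  have i2 : Integrable (fun ω : (Fin n → Z) × (Fin n × Fin n → W) => b (ω.1 p.2)) (pairLaw ν μ n) :=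
    hm2.integrable_comp_of_integrable hbi
  have i3 : Integrable (fun ω : (Fin n → Z) × (Fin n × Fin n → W) => c (ω.2 p)) (pairLaw ν μ n) :=
    hm3.integrable_comp_of_integrable hci
  have i12 : Integrable (fun ω : (Fin n → Z) × (Fin n × Fin n → W) => a (ω.1 p.1) * b (ω.1 p.2))
    (pairLaw ν μ n) := h1.integrable_mul i1 i2
  have e1 : ∫ ω, a (ω.1 p.1) ∂(pairLaw ν μ n) = ∫ z, a z ∂ν := by
    have := integral_map (μ := pairLaw ν μ n) hm1.measurable.aemeasurable (f := a)
      ha.aestronglyMeasurable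
    rw [hm1.map_eq] at this
    exact this.symm
  have e2 : ∫ ω, b (ω.1 p.2) ∂(pairLaw ν μ n) = ∫ z, b z ∂ν := by
    have := integral_map (μ := pairLaw ν μ n) hm2.measurable.aemeasurable (f := b)
      hb.aestronglyMeasurable
    rw [hm2.map_eq] at this
    exact this.symm
  have e3 : ∫ ω, c (ω.2 p) ∂(pairLaw ν μ n) = ∫ x, c x ∂μ := by
    have := integral_map (μ := pairLaw ν μ n) hm3.measurable.aemeasurable (f := c)
      hc.aestronglyMeasurable
    rw [hm3.map_eq] at this
    exact this.symm
  refine ⟨h2.integrable_mul i12 i3, ?_⟩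
  rw [h2.integral_fun_mul_eq_mul_integral i12.aestronglyMeasurable i3.aestronglyMeasurable,
    h1.integral_fun_mul_eq_mul_integral i1.aestronglyMeasurable i2.aestronglyMeasurable, e1, e2, e3]

/-- The diagonal has n of the n² pairs, at most half when n ≥ 2. -/
theorem half_mul_le_average [NeZero n] (hn : 2 ≤ n) {g : Fin n × Fin n → ℝ} {b : ℝ} (hb : 0 ≤ b)
    (h0 : ∀ p, 0 ≤ g p) (h : ∀ p : Fin n × Fin n, p.1 ≠ p.2 → b ≤ g p) :
    b / 2 ≤ (1 / (n : ℝ) ^ 2) • ∑ p, g p := by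
  have hn' : (2 : ℝ) ≤ n := by exact_mod_cast hn
  have h1 : ∑ p : Fin n × Fin n, (b - if p.1 = p.2 then b else 0) ≤ ∑ p, g p := by
    refine Finset.sum_le_sum fun p _ => ?_
    split_ifs with hp
    · simpa using h0 p
    · simpa using h p hp
  have h2 : ∑ p : Fin n × Fin n, (b - if p.1 = p.2 then b else 0) = (n : ℝ) ^ 2 * b - n * b := by
    rw [Finset.sum_sub_distrib, Fintype.sum_prod_type (fun p : Fin n × Fin n =>
      if p.1 = p.2 then b else 0)]
    simp [sq]
  rw [smul_eq_mul, one_div, le_inv_mul_iff₀ (by positivity)]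
  rw [h2] at h1
  refine le_trans ?_ h1
  nlinarith [mul_nonneg (mul_nonneg (by linarith : (0 : ℝ) ≤ n) hb) (by linarith : (0 : ℝ) ≤ n - 2)]

end Product

/-! ### Frequencies of good triples -/

section Frequencies

variable {d n : ℕ} {m : EuclideanSpace ℝ (Fin d)} {S : Matrix (Fin d) (Fin d) ℝ} {κ : ℝ}
  {𝓜 : Measure ((Fin d → ℝ) × ℝ)} [IsProbabilityMeasure 𝓜] {r τ β : ℝ} {M : Fin d → ℝ}

theorem integral_indicator_goodTriples_ge (hS : S.PosSemidef) (hκ : 1 ≤ κ) (hr : 0 < r)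
    (hκr : 2 * S.trace ≤ κ * r ^ 2) (hβ : 0 ≤ β)
    (hM : β ≤ 𝓜.real {p | p.1 = M ∧ p.2 ∈ Set.Icc τ (1 - τ)}) {p : Fin n × Fin n}
    (hp : p.1 ≠ p.2) :
    β / 16 ≤ ∫ ω, (goodTriples m r τ M).indicator (1 : Triple d → ℝ) (triple ω p)
      ∂(sampleLaw m S 𝓜 κ n) := by
  set A₁ : Set (EuclideanSpace ℝ (Fin d) × ℝ) := {z | z.2 = 1 ∧ ‖z.1 - m‖ ≤ r} with hA₁
  set A₀ : Set (EuclideanSpace ℝ (Fin d) × ℝ) := {z | z.2 = 0 ∧ ‖z.1 + m‖ ≤ r} with hA₀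
  set A : Set ((Fin d → ℝ) × ℝ) := {p | p.1 = M ∧ p.2 ∈ Set.Icc τ (1 - τ)} with hA
  have m₁ : MeasurableSet A₁ := .inter (measurableSet_eq_fun measurable_snd measurable_const) <|
      measurableSet_le (f := fun z : EuclideanSpace ℝ (Fin d) × ℝ => ‖z.1 - m‖) (by fun_prop)
        measurable_const
  have m₀ : MeasurableSet A₀ := .inter (measurableSet_eq_fun measurable_snd measurable_const) <|
      measurableSet_le (f := fun z : EuclideanSpace ℝ (Fin d) × ℝ => ‖z.1 + m‖) (by fun_prop)
        measurable_const
  have mA : MeasurableSet A :=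
    (measurable_fst (measurableSet_singleton M)).inter (measurable_snd measurableSet_Icc)
  have h := (integral_mul_pair (ν := dataDist m S κ) (μ := 𝓜) (a := A₁.indicator 1)
    (b := A₀.indicator 1) (c := A.indicator 1) hp (measurable_one.indicator m₁)
    (measurable_one.indicator m₀) (measurable_one.indicator mA)
    ((integrable_const 1).indicator m₁) ((integrable_const 1).indicator m₀)
    ((integrable_const 1).indicator mA)).2
  rw [integral_indicator_one m₁, integral_indicator_one m₀, integral_indicator_one mA] at h
  have h1 : ∀ ω : Sample d n, (goodTriples m r τ M).indicator (1 : Triple d → ℝ) (triple ω p) =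
      A₁.indicator 1 (ω.1 p.1) * A₀.indicator 1 (ω.1 p.2) * A.indicator 1 (ω.2 p) := by
    intro ω
    rw [mul_assoc, ← Set.indicator_prod_one, ← Set.indicator_prod_one]
    rfl
  simp_rw [h1]
  refine le_trans ?_ h.symm.le
  have q₁ := quarter_le_dataDist_one (m := m) hS hκ hr hκr
  have q₀ := quarter_le_dataDist_zero (m := m) hS hκ hr hκr
  calc β / 16 = 1 / 4 * (1 / 4) * β := by ring
    _ ≤ _ := by gcongr

/-- The expected frequency is at least β/32: an off-diagonal pair is good with probability at least
β/16 and the diagonal costs a factor 2. A lower deviation of β/64 leaves β/64. The exponential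
moment bound is 3 ≥ e, and 384 = 128 · 3. -/
theorem measureReal_goodTriples_lt_le [NeZero n] (hn : 2 ≤ n) (hS : S.PosSemidef) (hκ : 1 ≤ κ)
    (hr : 0 < r) (hκr : 2 * S.trace ≤ κ * r ^ 2) (hβ : 0 ≤ β)
    (hM : β ≤ 𝓜.real {p | p.1 = M ∧ p.2 ∈ Set.Icc τ (1 - τ)}) :
    (sampleLaw m S 𝓜 κ n).real
      {ω | ¬ β / 64 ≤ pairMean ((goodTriples m r τ M).indicator 1) ω} ≤
      Real.exp (-(n * ((β / 64) ^ 2 / 384))) := by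
  have hmG := measurableSet_goodTriples m r τ M
  set G := (goodTriples m r τ M).indicator (1 : Triple d → ℝ) with hG
  have hGm : Measurable G := measurable_one.indicator hmG
  have hG0 : ∀ t, 0 ≤ G t := fun t => Set.indicator_nonneg (fun _ _ => zero_le_one) t
  have hG1 : ∀ t, G t ≤ 1 := fun t =>
    Set.indicator_apply_le' (fun _ => le_rfl) (fun _ => zero_le_one)
  have hβ1 : β ≤ 1 := hM.trans measureReal_le_one
  have hmean := half_mul_le_average hn (by positivity : 0 ≤ β / 16)
    (g := fun p => ∫ ω, G (triple ω p) ∂(sampleLaw m S 𝓜 κ n))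
    (fun p => integral_nonneg fun ω => hG0 _)
    (fun p hp => integral_indicator_goodTriples_ge hS hκ hr hκr hβ hM hp)
  have hexp : ∀ t, Real.exp |-G t| ≤ 3 := by
    intro t
    rw [abs_neg, abs_of_nonneg (hG0 t)]
    exact (Real.exp_le_exp.2 (hG1 t)).trans (Real.exp_one_lt_d9.le.trans (by norm_num))
  have hint : ∀ p : Fin n × Fin n,
      Integrable (fun ω => Real.exp |-G (triple ω p)|) (sampleLaw m S 𝓜 κ n) := by
    intro p
    refine Integrable.of_bound (C := 3) ?_ (ae_of_all _ fun ω => ?_)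
    · exact (Real.measurable_exp.comp
        (hGm.comp (measurable_triple p)).neg.abs).aestronglyMeasurable
    · rw [Real.norm_eq_abs, abs_of_pos (Real.exp_pos _)]
      exact hexp _
  have h := measureReal_mean_pairs_ge_le (ν := dataDist m S κ) (μ := 𝓜) (n := n)
    (f := fun t : Triple d => -G t) (B := 3) hGm.neg hint (fun p => by
      calc _ ≤ ∫ _, (3 : ℝ) ∂(sampleLaw m S 𝓜 κ n) :=
            integral_mono (hint p) (integrable_const _) fun ω => hexp _
        _ = 3 := by simp) (η := β / 64) (by positivity) (by linarith)
  have he : -(n * (β / 64) ^ 2 / (128 * 3) : ℝ) = -(n * ((β / 64) ^ 2 / 384)) := by ring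
  rw [he] at h
  refine (measureReal_mono ?_).trans h
  intro ω hω
  have hω' : pairMean G ω < β / 64 := not_le.1 hω
  simp only [Set.mem_ofPred_eq]
  rw [Finset.sum_sub_distrib, mul_sub, Finset.sum_neg_distrib]
  simp_rw [integral_neg]
  rw [Finset.sum_neg_distrib]
  have e1 : 1 / (n : ℝ) ^ 2 * -∑ p : Fin n × Fin n, G (ω.1 p.1, ω.1 p.2, ω.2 p) = -pairMean G ω := by
    simp [pairMean, triple]
  rw [e1]
  change β / 16 / 2 ≤ 1 / (n : ℝ) ^ 2 * ∑ p : Fin n × Fin n,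
    ∫ ω, G (ω.1 p.1, ω.1 p.2, ω.2 p) ∂(pairLaw (dataDist m S κ) 𝓜 n) at hmean
  linarith

theorem measureReal_not_isGoodSample_le [NeZero n] (hn : 2 ≤ n) (hS : S.PosSemidef) (hκ : 1 ≤ κ)
    (h𝓜 : IsMaskLaw 𝓜) (hr : 0 < r) (hκr : 2 * S.trace ≤ κ * r ^ 2) (hβ : 0 ≤ β)
    {T : Finset (Fin d → ℝ)}
    (hT : ∀ M ∈ T, β ≤ 𝓜.real {p | p.1 = M ∧ p.2 ∈ Set.Icc τ (1 - τ)}) :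
    (sampleLaw m S 𝓜 κ n).real {ω | ¬ IsGoodSample m r τ T (β / 64) ω} ≤
      T.card * Real.exp (-(n * ((β / 64) ^ 2 / 384))) := by
  have h0 : (sampleLaw m S 𝓜 κ n).real {ω | ¬ ∀ p, IsRegularTriple (triple ω p)} = 0 := by
    rw [Measure.real, ae_iff.1 (ae_isRegularTriple h𝓜), ENNReal.toReal_zero]
  have hsub : {ω : Sample d n | ¬ IsGoodSample m r τ T (β / 64) ω} ⊆
      {ω | ¬ ∀ p, IsRegularTriple (triple ω p)} ∪
      ⋃ M ∈ T, {ω | ¬ β / 64 ≤ pairMean ((goodTriples m r τ M).indicator 1) ω} := by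
    intro ω hω
    by_cases h : ∀ p, IsRegularTriple (triple ω p)
    · right
      by_contra hcon
      simp only [Set.mem_iUnion, not_exists] at hcon
      exact hω ⟨h, fun M hM => not_not.1 (hcon M hM)⟩
    · left; exact h
  calc _ ≤ _ := measureReal_mono hsub (measure_ne_top _ _)
    _ ≤ _ := measureReal_union_le _ _
    _ ≤ 0 + ∑ M ∈ T, (sampleLaw m S 𝓜 κ n).real
        {ω | ¬ β / 64 ≤ pairMean ((goodTriples m r τ M).indicator 1) ω} := by
        rw [h0]
        gcongr
        exact measureReal_biUnion_finset_le _ _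
    _ ≤ 0 + ∑ M ∈ T, Real.exp (-(n * ((β / 64) ^ 2 / 384))) := by
        gcongr with M hM
        exact measureReal_goodTriples_lt_le hn hS hκ hr hκr hβ (hT M hM)
    _ = _ := by simp

end Frequencies

/-! ### Concentration of the gradient and its expectation at the origin -/

section Gradient

variable {d n : ℕ} {m : EuclideanSpace ℝ (Fin d)} {S : Matrix (Fin d) (Fin d) ℝ} {κ : ℝ}
  {𝓜 : Measure ((Fin d → ℝ) × ℝ)} [IsProbabilityMeasure 𝓜]

theorem expectedGrad_apply (hS : S.PosSemidef) (hκ : 1 ≤ κ) (h𝓜 : IsMaskLaw 𝓜)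
    (w : EuclideanSpace ℝ (Fin d)) (k : Fin d) :
    expectedGrad m S 𝓜 κ n w k = 1 / (n : ℝ) ^ 2 * ∑ p : Fin n × Fin n,
      ∫ ω, tripleGrad w (triple ω p) k ∂(sampleLaw m S 𝓜 κ n) := by
  have h1 : ∀ u : EuclideanSpace ℝ (Fin d),
      inner ℝ u (EuclideanSpace.single k (1 : ℝ)) = u k := fun u => by
    rw [EuclideanSpace.inner_single_right]; simp
  rw [← h1 (expectedGrad m S 𝓜 κ n w), inner_expectedGrad hS hκ h𝓜]
  simp_rw [inner_gradLoss, h1]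
  have h2 : ∀ p : Fin n × Fin n,
      Integrable (fun ω => tripleGrad w (triple ω p) k) (sampleLaw m S 𝓜 κ n) := fun p => by
    simp_rw [← h1 (tripleGrad _ _)]
    exact (integrable_tripleGrad hS hκ h𝓜 w p).inner_const _
  rw [integral_pairMean (f := fun t => tripleGrad w t k) h2, smul_eq_mul]

/-- The tail bound is applied to each coordinate and its negative at the fixed point w, where the
means of the summands average to zero; the norm is at most the sum of the d absolute coordinates. -/
theorem measureReal_gradLoss_le [NeZero n] (hS : S.PosSemidef) (hκ : 1 ≤ κ) (h𝓜 : IsMaskLaw 𝓜)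
    {w : EuclideanSpace ℝ (Fin d)} (hw : expectedGrad m S 𝓜 κ n w = 0) {η : ℝ} (hη : 0 ≤ η)
    (hη1 : η ≤ 1) :
    (sampleLaw m S 𝓜 κ n).real {ω | ¬ ‖gradLoss ω w‖ ≤ d * η} ≤
      2 * d * Real.exp (-(n * η ^ 2 / (128 * momentBound m S))) := by
  have hmeas : ∀ k, Measurable fun t : Triple d => tripleGrad w t k := fun k =>
    (by fun_prop : Measurable fun x : EuclideanSpace ℝ (Fin d) => x k).comp (measurable_tripleGrad w)
  have hpos : ∀ k, (sampleLaw m S 𝓜 κ n).real {ω | η ≤ gradLoss ω w k} ≤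
      Real.exp (-(n * η ^ 2 / (128 * momentBound m S))) := by
    intro k
    have hb := fun p => exp_abs_triple (m := m) (n := n) hS hκ h𝓜 (hmeas k)
      (fun t ht => ht.abs_grad_le w k) p
    refine (measureReal_mono ?_).trans (measureReal_mean_pairs_ge_le (ν := dataDist m S κ)
      (μ := 𝓜) (n := n) (hmeas k) (fun p => (hb p).1) (fun p => (hb p).2) hη hη1)
    intro ω hω
    have h1 := expectedGrad_apply (m := m) (n := n) hS hκ h𝓜 w k
    rw [hw, PiLp.zero_apply] at h1
    simp only [Set.mem_ofPred_eq] at hω ⊢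
    rw [Finset.sum_sub_distrib, mul_sub]
    change _ ≤ _ - 1 / (n : ℝ) ^ 2 * ∑ p : Fin n × Fin n,
      ∫ ω, tripleGrad w (triple ω p) k ∂(sampleLaw m S 𝓜 κ n)
    rw [← h1, sub_zero]
    refine hω.trans (le_of_eq ?_)
    simp [gradLoss, pairMean, triple]
  have hneg : ∀ k, (sampleLaw m S 𝓜 κ n).real {ω | η ≤ -gradLoss ω w k} ≤
      Real.exp (-(n * η ^ 2 / (128 * momentBound m S))) := by
    intro k
    have hb := fun p => exp_abs_triple (m := m) (n := n) hS hκ h𝓜 (hmeas k).neg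
      (fun t ht => (abs_neg (tripleGrad w t k)).le.trans (ht.abs_grad_le w k)) p
    refine (measureReal_mono ?_).trans (measureReal_mean_pairs_ge_le (ν := dataDist m S κ)
      (μ := 𝓜) (n := n) (hmeas k).neg (fun p => (hb p).1) (fun p => (hb p).2) hη hη1)
    intro ω hω
    have h1 := expectedGrad_apply (m := m) (n := n) hS hκ h𝓜 w k
    rw [hw, PiLp.zero_apply] at h1
    simp only [Set.mem_ofPred_eq] at hω ⊢
    simp only [Pi.neg_apply, integral_neg]
    rw [Finset.sum_sub_distrib, mul_sub, Finset.sum_neg_distrib, Finset.sum_neg_distrib]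
    change _ ≤ _ - 1 / (n : ℝ) ^ 2 * -∑ p : Fin n × Fin n,
      ∫ ω, tripleGrad w (triple ω p) k ∂(sampleLaw m S 𝓜 κ n)
    rw [mul_neg, mul_neg, ← h1, neg_zero, sub_zero]
    refine hω.trans (le_of_eq ?_)
    simp [gradLoss, pairMean, triple]
  have hsub : {ω : Sample d n | ¬ ‖gradLoss ω w‖ ≤ d * η} ⊆
      ⋃ k ∈ (Finset.univ : Finset (Fin d)),
        ({ω | η ≤ gradLoss ω w k} ∪ {ω | η ≤ -gradLoss ω w k}) := by
    intro ω hω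
    by_contra hcon
    simp only [Finset.mem_univ, Set.mem_iUnion, Set.mem_union, Set.mem_ofPred_eq, exists_prop,
      true_and, not_exists, not_or, not_le] at hcon
    refine hω ?_
    have h1 : ‖gradLoss ω w‖ ≤ ∑ k, |gradLoss ω w k| := by
      have h2 := (EuclideanSpace.basisFun (Fin d) ℝ).sum_repr (gradLoss ω w)
      calc ‖gradLoss ω w‖ = ‖∑ k, gradLoss ω w k • EuclideanSpace.basisFun (Fin d) ℝ k‖ := by
            conv_lhs => rw [← h2]
            simp
        _ ≤ ∑ k, ‖gradLoss ω w k • EuclideanSpace.basisFun (Fin d) ℝ k‖ := norm_sum_le _ _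
        _ = _ := by simp [norm_smul]
    refine h1.trans ((Finset.sum_le_card_nsmul _ _ η fun k _ => ?_).trans (by simp))
    exact abs_le.2 ⟨by linarith [(hcon k).2], (hcon k).1.le⟩
  calc _ ≤ _ := measureReal_mono hsub (measure_ne_top _ _)
    _ ≤ _ := measureReal_biUnion_finset_le _ _
    _ ≤ ∑ _k : Fin d, (Real.exp (-(n * η ^ 2 / (128 * momentBound m S))) +
        Real.exp (-(n * η ^ 2 / (128 * momentBound m S)))) :=
        Finset.sum_le_sum fun k _ => (measureReal_union_le _ _).trans (add_le_add (hpos k) (hneg k))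
    _ = _ := by simp; ring

theorem tripleGrad_zero_apply (t : Triple d) (k : Fin d) :
    tripleGrad 0 t k = (1 / 2 - tripleLabel t) * triplePoint t k := by
  simp [tripleGrad]

/-- The probability, given the mask, that the ratio and the coordinate `k` of the mask select the
same point. -/
def agreement (k : Fin d) (p : (Fin d → ℝ) × ℝ) : ℝ := p.2 * p.1 k + (1 - p.2) * (1 - p.1 k)

theorem integral_tripleGrad_zero_diag (hS : S.PosSemidef) (hκ : 1 ≤ κ) {p : Fin n × Fin n}
    (hp : p.1 = p.2) (k : Fin d) :
    ∫ ω, tripleGrad 0 (triple ω p) k ∂(sampleLaw m S 𝓜 κ n) = -(m k / 2) := by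
  have h1 : ∀ ω : Sample d n,
      tripleGrad 0 (triple ω p) k = (1 / 2 - (ω.1 p.1).2) * (ω.1 p.1).1 k := by
    intro ω
    rw [tripleGrad_zero_apply, tripleLabel, triplePoint, maskPoint_apply]
    simp only [triple, ← hp]
    ring
  simp_rw [h1]
  have hmp := measurePreserving_point (ν := dataDist m S κ) (μ := 𝓜) p.1
  have h := integral_map (μ := pairLaw (dataDist m S κ) 𝓜 n) hmp.measurable.aemeasurable
    (f := fun z : EuclideanSpace ℝ (Fin d) × ℝ => (1 / 2 - z.2) * z.1 k)
    (Measurable.aestronglyMeasurable (by fun_prop))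
  rw [hmp.map_eq, integral_label_mul_coord_dataDist hS hκ] at h
  exact h.symm

theorem integral_tripleGrad_zero_offDiag (hS : S.PosSemidef) (hκ : 1 ≤ κ) (h𝓜 : IsMaskLaw 𝓜)
    {p : Fin n × Fin n} (hp : p.1 ≠ p.2) (k : Fin d) :
    ∫ ω, tripleGrad 0 (triple ω p) k ∂(sampleLaw m S 𝓜 κ n) =
      -(m k / 2) * ∫ x, agreement k x ∂𝓜 := by
  have hc : ∀ c : (Fin d → ℝ) × ℝ → ℝ, Measurable c →
      (∀ x, (∀ k, x.1 k = 0 ∨ x.1 k = 1) ∧ x.2 ∈ Set.Icc (0 : ℝ) 1 → |c x| ≤ 1) →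
      Integrable c 𝓜 := fun c hcm hcb => by
    refine Integrable.of_bound (C := 1) hcm.aestronglyMeasurable ?_
    filter_upwards [h𝓜.ae_mem] with x hx using hcb x hx
  have b1 : ∀ x : (Fin d → ℝ) × ℝ, (∀ k, x.1 k = 0 ∨ x.1 k = 1) ∧ x.2 ∈ Set.Icc (0 : ℝ) 1 →
      |x.2 * x.1 k| ≤ 1 ∧ |x.2 * (1 - x.1 k)| ≤ 1 ∧ |(1 - x.2) * x.1 k| ≤ 1 ∧
      |(1 - x.2) * (1 - x.1 k)| ≤ 1 := by
    rintro x ⟨h1, h2, h3⟩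
    rcases h1 k with h | h <;> rw [h] <;> simp only [abs_le] <;>
      refine ⟨⟨?_, ?_⟩, ⟨?_, ?_⟩, ⟨?_, ?_⟩, ?_, ?_⟩ <;> linarith
  have hs : Measurable fun z : EuclideanSpace ℝ (Fin d) × ℝ => 1 / 2 - z.2 := by fun_prop
  have hx : Measurable fun z : EuclideanSpace ℝ (Fin d) × ℝ => z.1 k := by fun_prop
  have hsx : Measurable fun z : EuclideanSpace ℝ (Fin d) × ℝ => (1 / 2 - z.2) * z.1 k := hs.mul hx
  have m1 : Measurable fun x : (Fin d → ℝ) × ℝ => x.2 * x.1 k := by fun_prop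
  have m2 : Measurable fun x : (Fin d → ℝ) × ℝ => x.2 * (1 - x.1 k) := by fun_prop
  have m3 : Measurable fun x : (Fin d → ℝ) × ℝ => (1 - x.2) * x.1 k := by fun_prop
  have m4 : Measurable fun x : (Fin d → ℝ) × ℝ => (1 - x.2) * (1 - x.1 k) := by fun_prop
  have c1 := hc _ m1 fun x h => (b1 x h).1
  have c2 := hc _ m2 fun x h => (b1 x h).2.1
  have c3 := hc _ m3 fun x h => (b1 x h).2.2.1
  have c4 := hc _ m4 fun x h => (b1 x h).2.2.2
  have is := integrable_label_dataDist (m := m) (S := S) (κ := κ)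
  have ix := integrable_coord_dataDist (m := m) hS hκ k
  have isx := integrable_label_mul_coord_dataDist (m := m) hS hκ k
  have one : Integrable (fun _ : EuclideanSpace ℝ (Fin d) × ℝ => (1 : ℝ)) (dataDist m S κ) :=
    integrable_const 1
  obtain ⟨i1, e1⟩ := integral_mul_pair hp hsx measurable_const m1 isx one c1
  obtain ⟨i2, e2⟩ := integral_mul_pair hp hs hx m2 is ix c2
  obtain ⟨i3, e3⟩ := integral_mul_pair hp hx hs m3 ix is c3
  obtain ⟨i4, e4⟩ := integral_mul_pair hp measurable_const hsx m4 one isx c4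
  rw [integral_label_mul_coord_dataDist hS hκ] at e1 e4
  rw [integral_coord_dataDist hS hκ, integral_label_dataDist] at e2 e3
  -- Writing 1/2 - ỹ = λ(1/2 - y_i) + (1 - λ)(1/2 - y_j) gives four products of independent factors.
  -- The two that pair the label of one point with the other point vanish, since both are centred.
  have h1 : ∀ ω : Sample d n, tripleGrad 0 (triple ω p) k =
      ((1 / 2 - (ω.1 p.1).2) * (ω.1 p.1).1 k * 1 * ((ω.2 p).2 * (ω.2 p).1 k) +
      (1 / 2 - (ω.1 p.1).2) * (ω.1 p.2).1 k * ((ω.2 p).2 * (1 - (ω.2 p).1 k))) +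
      ((ω.1 p.1).1 k * (1 / 2 - (ω.1 p.2).2) * ((1 - (ω.2 p).2) * (ω.2 p).1 k) +
      1 * ((1 / 2 - (ω.1 p.2).2) * (ω.1 p.2).1 k) * ((1 - (ω.2 p).2) * (1 - (ω.2 p).1 k))) := by
    intro ω
    rw [tripleGrad_zero_apply, tripleLabel, triplePoint, maskPoint_apply]
    simp only [triple]
    ring
  simp_rw [h1]
  have e12 := integral_add i1 i2
  have e34 := integral_add i3 i4
  have i12 := i1.add i2
  have i34 := i3.add i4
  have e := integral_add i12 i34
  simp only [Pi.add_apply] at e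
  refine e.trans ?_
  rw [e12, e34, e1, e2, e3, e4]
  unfold agreement
  rw [integral_add c1 c4]
  simp
  ring

theorem mul_le_integral_agreement (h𝓜 : IsMaskLaw 𝓜) {τ β : ℝ} (hτ : 0 ≤ τ) {M : Fin d → ℝ}
    (hM : ∀ k, M k = 0 ∨ M k = 1)
    (hβ : β ≤ 𝓜.real {p | p.1 = M ∧ p.2 ∈ Set.Icc τ (1 - τ)}) (k : Fin d) :
    τ * β ≤ ∫ x, agreement k x ∂𝓜 := by
  set A : Set ((Fin d → ℝ) × ℝ) := {p | p.1 = M ∧ p.2 ∈ Set.Icc τ (1 - τ)} with hA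
  have mA : MeasurableSet A :=
    (measurable_fst (measurableSet_singleton M)).inter (measurable_snd measurableSet_Icc)
  have hb : ∀ x : (Fin d → ℝ) × ℝ, (∀ k, x.1 k = 0 ∨ x.1 k = 1) ∧ x.2 ∈ Set.Icc (0 : ℝ) 1 →
      agreement k x ∈ Set.Icc (0 : ℝ) 1 := by
    rintro x ⟨h1, h2, h3⟩
    unfold agreement
    rcases h1 k with h | h <;> rw [h] <;> constructor <;> linarith
  have hI : Integrable (agreement k) 𝓜 := by
    refine Integrable.of_bound (C := 1) (Measurable.aestronglyMeasurable
      (by unfold agreement; fun_prop)) ?_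
    filter_upwards [h𝓜.ae_mem] with x hx
    rw [Real.norm_eq_abs, abs_of_nonneg (hb x hx).1]
    exact (hb x hx).2
  have h1 : ∫ x, A.indicator (fun _ => τ) x ∂𝓜 ≤ ∫ x, agreement k x ∂𝓜 := by
    refine integral_mono_ae ((integrable_const τ).indicator mA) hI ?_
    filter_upwards [h𝓜.ae_mem] with x hx
    by_cases h : x ∈ A
    · rw [Set.indicator_of_mem h]
      obtain ⟨h2, h3, h4⟩ := h
      unfold agreement
      rw [h2]
      rcases hM k with h | h <;> rw [h] <;> linarith
    · rw [Set.indicator_of_notMem h]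
      exact (hb x hx).1
  rw [integral_indicator_const _ mA, smul_eq_mul] at h1
  nlinarith

/-- Tested against m, every pair contributes at most -(ρ/2)‖m‖²: off-diagonal pairs by the agreement
bound, diagonal pairs, whose factor is 1, because ρ ≤ 1. -/
theorem norm_expectedGrad_zero_ge [NeZero n] (hm : m ≠ 0) (hS : S.PosSemidef) (hκ : 1 ≤ κ)
    (h𝓜 : IsMaskLaw 𝓜) {ρ : ℝ} (hρ : ρ ≤ 1) (hag : ∀ k : Fin d, ρ ≤ ∫ x, agreement k x ∂𝓜) :
    ρ * ‖m‖ / 2 ≤ ‖expectedGrad m S 𝓜 κ n 0‖ := by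
  have hmn : 0 < ‖m‖ := norm_pos_iff.2 hm
  have hk : ∀ k : Fin d, expectedGrad m S 𝓜 κ n 0 k * m k ≤ -(ρ / 2 * m k ^ 2) := by
    intro k
    rw [expectedGrad_apply hS hκ h𝓜, mul_assoc, Finset.sum_mul, ← smul_eq_mul (1 / (n : ℝ) ^ 2)]
    refine average_le fun p => ?_
    by_cases hp : p.1 = p.2
    · rw [integral_tripleGrad_zero_diag hS hκ hp]
      nlinarith [sq_nonneg (m k)]
    · rw [integral_tripleGrad_zero_offDiag hS hκ h𝓜 hp]
      nlinarith [mul_le_mul_of_nonneg_right (hag k) (sq_nonneg (m k))]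
  have h1 : inner ℝ (expectedGrad m S 𝓜 κ n 0) m ≤ -(ρ / 2 * ‖m‖ ^ 2) := by
    rw [PiLp.inner_apply, EuclideanSpace.norm_sq_eq, Finset.mul_sum, ← Finset.sum_neg_distrib]
    refine Finset.sum_le_sum fun k _ => ?_
    have := hk k
    simp only [Real.norm_eq_abs, sq_abs]
    simpa [mul_comm] using this
  have h2 := abs_le.1 (abs_real_inner_le_norm (expectedGrad m S 𝓜 κ n 0) m)
  have h3 : ρ * ‖m‖ / 2 * ‖m‖ ≤ ‖expectedGrad m S 𝓜 κ n 0‖ * ‖m‖ := by nlinarith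
  exact le_of_mul_le_mul_right h3 hmn

end Gradient

/-! ### Choice of constants and conclusion -/

/-- The complement of a measurable hull of N; thus the bad events need not be shown measurable. -/
theorem exists_measurableSet_disjoint {Ω : Type*} {mΩ : MeasurableSpace Ω} {P : Measure Ω}
    [IsProbabilityMeasure P] {N : Set Ω} {δ : ℝ} (hN : P.real N ≤ δ) :
    ∃ A, MeasurableSet A ∧ 1 - δ ≤ P.real A ∧ ∀ ω ∈ A, ω ∉ N := by
  have hm := measurableSet_toMeasurable P N
  refine ⟨(toMeasurable P N)ᶜ, hm.compl, ?_, fun ω hω h => hω (subset_toMeasurable P N h)⟩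
  rw [probReal_compl_eq_one_sub hm]
  have : P.real (toMeasurable P N) = P.real N := by rw [Measure.real, measure_toMeasurable]; rfl
  linarith

theorem mul_exp_neg_le_half {D x δ : ℝ} (hD : 0 ≤ D) (hδ : 0 < δ)
    (hx : 2 * D + Real.log (1 / δ) ≤ x) : D * Real.exp (-x) ≤ δ / 2 := by
  have h1 : Real.exp (-x) ≤ δ * Real.exp (-(2 * D)) := by
    calc Real.exp (-x) ≤ Real.exp (Real.log δ + -(2 * D)) := by
          rw [one_div, Real.log_inv] at hx
          exact Real.exp_le_exp.2 (by linarith)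
      _ = _ := by rw [Real.exp_add, Real.exp_log hδ]
  have h2 : D * Real.exp (-(2 * D)) ≤ 1 / 2 := by
    rw [Real.exp_neg, ← div_eq_mul_inv, div_le_iff₀ (Real.exp_pos _)]
    linarith [Real.add_one_le_exp (2 * D)]
  calc D * Real.exp (-x) ≤ D * (δ * Real.exp (-(2 * D))) := by gcongr
    _ = δ * (D * Real.exp (-(2 * D))) := by ring
    _ ≤ δ * (1 / 2) := by gcongr
    _ = δ / 2 := by ring

theorem exists_minimizers_cosSim_ge {d n : ℕ} [NeZero n] {m : EuclideanSpace ℝ (Fin d)}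
    {S : Matrix (Fin d) (Fin d) ℝ} {κ : ℝ} {𝓜 : Measure ((Fin d → ℝ) × ℝ)}
    [IsProbabilityMeasure 𝓜] (hS : S.PosSemidef) (hκ : 1 ≤ κ) (h𝓜 : IsMaskLaw 𝓜)
    {G : Set (Sample d n)} {a R α ρ η ε δ : ℝ} (ha : 0 < a) (hR : Real.log 2 ≤ a / 2 * R)
    (hα : 0 < α) (hρ : 0 < ρ) (hη : 0 ≤ η) (hη1 : η ≤ 1) (hε : 0 ≤ ε) (hε1 : ε ≤ 1) (hδ1 : δ ≤ 1)
    (hcoer : ∀ ω ∈ G, ∀ w, a * ‖w‖ ≤ maskLoss ω w)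
    (hstrong : ∀ ω ∈ G, ∀ v w, ‖v‖ ≤ R → ‖w‖ ≤ R →
      maskLoss ω w + inner ℝ (gradLoss ω w) (v - w) + α / 2 * ‖v - w‖ ^ 2 ≤ maskLoss ω v)
    (hgrad : 4 * (d * momentBound m S + 1) * ρ ≤ ‖expectedGrad m S 𝓜 κ n 0‖)
    (hdη : d * η ≤ α * ρ / 4 * ε) (hG : (sampleLaw m S 𝓜 κ n).real Gᶜ ≤ δ / 2)
    (hexp : 2 * d * Real.exp (-(n * η ^ 2 / (128 * momentBound m S))) ≤ δ / 2) :
    ∃ wStar : EuclideanSpace ℝ (Fin d),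
      IsUniqueMinimizer (expectedMaskLoss m S 𝓜 κ n) wStar ∧
      ∃ A : Set (Sample d n), MeasurableSet A ∧
        ENNReal.ofReal (1 - δ) ≤ sampleLaw m S 𝓜 κ n A ∧
        ∀ ω ∈ A, ∃ wHat : EuclideanSpace ℝ (Fin d),
          IsUniqueMinimizer (maskLoss ω) wHat ∧ 1 - ε ≤ cosSim wHat wStar := by
  have hB : 0 < d * momentBound m S + 1 := by
    have := momentBound_pos m S
    positivity
  obtain ⟨A₁, hA₁, hPA₁, hA₁good⟩ := exists_measurableSet_disjoint hG
  -- The bad event has measure at most δ/2 ≤ 1/2.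
  have hPA₁' : 1 / 2 ≤ (sampleLaw m S 𝓜 κ n).real A₁ := by linarith
  have hA₁g : ∀ ω ∈ A₁, ω ∈ G := fun ω hω => Set.notMem_compl_iff.1 (hA₁good ω hω)
  have hlow := expectedMaskLoss_lower (m := m) (n := n) hS hκ h𝓜
  have hup := expectedMaskLoss_upper (m := m) (n := n) hS hκ h𝓜
  have hEcoer : ∀ w, a / 2 * ‖w‖ ≤ expectedMaskLoss m S 𝓜 κ n w := fun w =>
    expectedMaskLoss_coercive hS hκ h𝓜 hA₁ hPA₁' ha.le w fun ω hω => hcoer ω (hA₁g ω hω) w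
  have hE0 : expectedMaskLoss m S 𝓜 κ n 0 ≤ a / 2 * R := by
    refine le_trans (le_of_eq ?_) hR
    rw [expectedMaskLoss]
    simp_rw [maskLoss_zero]
    simp
  have hEstrong : ∀ v w, ‖v‖ ≤ R → ‖w‖ ≤ R →
      expectedMaskLoss m S 𝓜 κ n w + inner ℝ (expectedGrad m S 𝓜 κ n w) (v - w) +
        α / 2 / 2 * ‖v - w‖ ^ 2 ≤ expectedMaskLoss m S 𝓜 κ n v := fun v w hv hw =>
    expectedMaskLoss_strong hS hκ h𝓜 hA₁ hPA₁' hα.le v w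
      fun ω hω => hstrong ω (hA₁g ω hω) v w hv hw
  obtain ⟨wStar, hwStar⟩ := exists_isUniqueMinimizer (continuous_of_quadratic_bounds hlow hup)
    (half_pos ha) hEcoer hE0 (half_pos hα) hEstrong
  have hwR := norm_le_of_coercive (half_pos ha) hEcoer hE0 hwStar.1
  have hgrad0 := gradient_eq_zero_of_minimizer hB hup hwStar.1
  have hwρ : ρ ≤ ‖wStar‖ := by
    have h2 := norm_gradient_zero_le hB hlow hup hwStar.1
    exact le_of_mul_le_mul_left (hgrad.trans h2) (by positivity)
  have hw0 : wStar ≠ 0 := norm_pos_iff.1 (hρ.trans_le hwρ)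
  refine ⟨wStar, hwStar, ?_⟩
  -- The point `wStar` does not depend on the sample, so the pointwise tail bound applies.
  have hbad₂ : (sampleLaw m S 𝓜 κ n).real {ω | ¬ ‖gradLoss ω wStar‖ ≤ d * η} ≤ δ / 2 :=
    (measureReal_gradLoss_le hS hκ h𝓜 hgrad0 hη hη1).trans hexp
  have hbad : (sampleLaw m S 𝓜 κ n).real (Gᶜ ∪ {ω | ¬ ‖gradLoss ω wStar‖ ≤ d * η}) ≤ δ :=
    (measureReal_union_le _ _).trans (by linarith)
  obtain ⟨A, hA, hPA, hAgood⟩ := exists_measurableSet_disjoint hbad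
  refine ⟨A, hA, ?_, fun ω hω => ?_⟩
  · rw [← ENNReal.ofReal_toReal (measure_ne_top (sampleLaw m S 𝓜 κ n) A)]
    exact ENNReal.ofReal_le_ofReal hPA
  have hω' := hAgood ω hω
  rw [Set.mem_union, not_or, Set.notMem_compl_iff] at hω'
  obtain ⟨hgood, hgω⟩ := hω'
  replace hgω : ‖gradLoss ω wStar‖ ≤ d * η := not_not.1 hgω
  have h0 : maskLoss ω 0 ≤ a * R := by
    rw [maskLoss_zero]
    linarith [Real.log_pos one_lt_two]
  obtain ⟨wHat, hwHat⟩ := exists_isUniqueMinimizer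
    (continuous_of_quadratic_bounds (maskLoss_lower ω) (maskLoss_upper ω)) ha (hcoer ω hgood) h0
    hα (hstrong ω hgood)
  refine ⟨wHat, hwHat, one_sub_le_cosSim hw0 hε hε1 ?_⟩
  have hwHatR := norm_le_of_coercive ha (hcoer ω hgood) h0 hwHat.1
  refine (norm_sub_minimizer_le hα (hstrong ω hgood) hwHatR hwR hwHat.1).trans ?_
  rw [div_le_iff₀ hα]
  -- The distance is at most 2dη/α ≤ (ε/2)ρ ≤ (ε/2)‖wStar‖.
  have h4 : ε / 2 * ρ * α ≤ ε / 2 * ‖wStar‖ * α := by gcongr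
  linarith

end MaskMixup

end

set_option maxHeartbeats 1000000 in
open MaskMixup in
theorem theorem7 {d : ℕ} (m : EuclideanSpace ℝ (Fin d)) (S : Matrix (Fin d) (Fin d) ℝ)
    (hm : m ≠ 0) (hS : S.PosDef) (hmS : ‖m‖ ^ 2 = ‖Matrix.toEuclideanCLM (𝕜 := ℝ) S‖)
    (𝓜 : Measure ((Fin d → ℝ) × ℝ)) [IsProbabilityMeasure 𝓜]
    (h𝓜 : MaskMixup.IsMaskLaw 𝓜) (hmask : MaskMixup.MaskAssumption m 𝓜) :
    ∃ C : ℝ, 0 < C ∧ ∃ κ₀ : ℝ, 0 < κ₀ ∧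
      ∀ κ : ℝ, κ₀ ≤ κ → ∀ ε ∈ Set.Ioo (0 : ℝ) 1, ∀ δ ∈ Set.Ioo (0 : ℝ) 1, ∀ n : ℕ,
        C / ε ^ 4 * (1 + Real.log (1 / ε) + Real.log (1 / δ)) ≤ (n : ℝ) →
        (∀ w : EuclideanSpace ℝ (Fin d),
          Integrable (fun ω => MaskMixup.maskLoss ω w) (MaskMixup.sampleLaw m S 𝓜 κ n)) ∧
        ∃ wStar : EuclideanSpace ℝ (Fin d),
          MaskMixup.IsUniqueMinimizer (MaskMixup.expectedMaskLoss m S 𝓜 κ n) wStar ∧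
          ∃ A : Set (MaskMixup.Sample d n), MeasurableSet A ∧
            ENNReal.ofReal (1 - δ) ≤ MaskMixup.sampleLaw m S 𝓜 κ n A ∧
            ∀ ω ∈ A, ∃ wHat : EuclideanSpace ℝ (Fin d),
              MaskMixup.IsUniqueMinimizer (MaskMixup.maskLoss ω) wHat ∧
              1 - ε ≤ MaskMixup.cosSim wHat wStar := by
  clear hmS
  obtain ⟨T, τ, β, c, hτ, hβ, hc, hTbin, hTβ, hframe⟩ := exists_masks hm h𝓜 hmask
  obtain ⟨M₀, hM₀, -⟩ := hframe 0
  have hS' := hS.posSemidef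
  have hmn : 0 < ‖m‖ := norm_pos_iff.2 hm
  have hK0 : 0 < momentBound m S := momentBound_pos m S
  have hlog2 : 0 < Real.log 2 := Real.log_pos one_lt_two
  have hr0 : 0 < c / 4 := by positivity
  have hrc : 4 * (c / 4) ≤ c := by linarith
  obtain ⟨a, ha⟩ : ∃ a, a = β / 64 * (τ * (c / 2)) := ⟨_, rfl⟩
  have ha0 : 0 < a := by rw [ha]; positivity
  -- Both losses equal log 2 at 0. The expected loss is coercive with a/2 only, which dictates the
  -- radius; it then also serves the empirical loss.
  obtain ⟨R, hR⟩ : ∃ R, R = Real.log 2 / (a / 2) := ⟨_, rfl⟩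
  have haR : Real.log 2 = a / 2 * R := by rw [hR]; field_simp
  obtain ⟨α, hα⟩ : ∃ α, α = β / 64 * logisticModulus (R * (‖m‖ + 2 * (c / 4))) * (c / 2) ^ 2 :=
    ⟨_, rfl⟩
  have hα0 : 0 < α := by
    have := logisticModulus_pos (R * (‖m‖ + 2 * (c / 4)))
    rw [hα]; positivity
  -- The lower bound of the gradient at 0 divided by four times the smoothness constant; it will
  -- bound ‖wStar‖ below.
  obtain ⟨ρ, hρ⟩ : ∃ ρ, ρ = min 1 (τ * β) * ‖m‖ / 2 / (4 * (d * momentBound m S + 1)) := ⟨_, rfl⟩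
  have hρ0 : 0 < ρ := by rw [hρ]; positivity
  obtain ⟨η, hη⟩ : ∃ η, η = min 1 (α * ρ / (4 * (d + 1))) := ⟨_, rfl⟩
  have hη0 : 0 < η := by rw [hη]; positivity
  obtain ⟨c₁, hc₁⟩ : ∃ c₁ : ℝ, c₁ = (β / 64) ^ 2 / 384 := ⟨_, rfl⟩
  have hc₁0 : 0 < c₁ := by rw [hc₁]; positivity
  obtain ⟨c₂, hc₂⟩ : ∃ c₂ : ℝ, c₂ = η ^ 2 / (128 * momentBound m S) := ⟨_, rfl⟩
  have hc₂0 : 0 < c₂ := by rw [hc₂]; positivity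
  have hT0 : 0 ≤ (T.card : ℝ) := T.card.cast_nonneg
  have hd0 : 0 ≤ 2 * (d : ℝ) := mul_nonneg two_pos.le d.cast_nonneg
  have hC₁0 : 0 < (2 * (T.card : ℝ) + 1) / c₁ := div_pos (by linarith) hc₁0
  have hC₂0 : 0 < (2 * (2 * (d : ℝ)) + 1) / c₂ := div_pos (by linarith) hc₂0
  -- The summand 2 forces n ≥ 2; the other two make the failure probabilities of the good sample and
  -- of the gradient bound at most δ/2 each.
  obtain ⟨C, hC⟩ : ∃ C, C = 2 + (2 * (T.card : ℝ) + 1) / c₁ + (2 * (2 * (d : ℝ)) + 1) / c₂ :=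
    ⟨_, rfl⟩
  have hC0 : 0 < C := by linarith
  -- The radius r = c/4 costs half of the frame constant; κ₀ lets each class put half of its mass
  -- within r of its mean.
  refine ⟨C, hC0, max 1 (2 * S.trace / (c / 4) ^ 2), lt_max_of_lt_left one_pos, ?_⟩
  rintro κ hκ₀ ε ⟨hε0, hε1⟩ δ ⟨hδ0, hδ1⟩ n hn
  have hκ : 1 ≤ κ := (le_max_left _ _).trans hκ₀
  have hκr : 2 * S.trace ≤ κ * (c / 4) ^ 2 := by
    have := (le_max_right _ _).trans hκ₀
    rwa [div_le_iff₀ (by positivity)] at this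
  have hlδ : 0 < Real.log (1 / δ) := Real.log_pos (by rw [lt_div_iff₀ hδ0]; linarith)
  have hlε : 0 < Real.log (1 / ε) := Real.log_pos (by rw [lt_div_iff₀ hε0]; linarith)
  -- Only n ε² enters the tail bounds, as the gradient deviation is η ε; the term log(1/ε) and two
  -- powers of ε are dropped.
  have hnε : C * (1 + Real.log (1 / δ)) ≤ n * ε ^ 2 := by
    have h1 : C / ε ^ 4 * (1 + Real.log (1 / δ)) ≤ n :=
      (mul_le_mul_of_nonneg_left (by linarith) (by positivity)).trans hn
    rw [div_mul_eq_mul_div, div_le_iff₀ (by positivity)] at h1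
    exact h1.trans (mul_le_mul_of_nonneg_left
      (pow_le_pow_of_le_one hε0.le hε1.le (by norm_num)) (by positivity))
  have hnC : C * (1 + Real.log (1 / δ)) ≤ n := hnε.trans
    (mul_le_of_le_one_right (by positivity) (pow_le_one₀ hε0.le hε1.le))
  have hn2 : 2 ≤ n := by
    have : (2 : ℝ) ≤ n := by nlinarith
    exact_mod_cast this
  have : NeZero n := ⟨by omega⟩
  have hcount : ∀ D b x : ℝ, 0 ≤ D → 0 < b → (2 * D + 1) / b ≤ C →
      C * (1 + Real.log (1 / δ)) ≤ x → 2 * D + Real.log (1 / δ) ≤ x * b := by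
    intro D b x hD hb h1 h2
    rw [div_le_iff₀ hb] at h1
    nlinarith [mul_le_mul_of_nonneg_right h2 hb.le,
      mul_le_mul_of_nonneg_right h1 (by linarith : 0 ≤ 1 + Real.log (1 / δ)),
      mul_nonneg hD hlδ.le]
  refine ⟨fun w => integrable_maskLoss hS' hκ h𝓜 w, ?_⟩
  refine exists_minimizers_cosSim_ge hS' hκ h𝓜 (η := η * ε)
    (G := {ω | IsGoodSample m (c / 4) τ T (β / 64) ω}) ha0 haR.le hα0 hρ0 (by positivity)
    (mul_le_one₀ (hη ▸ min_le_left _ _) hε0.le hε1.le) hε0.le hε1.le hδ1.le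
    (fun ω hω w => ha ▸ hω.coercive hr0.le hrc hτ.le hTbin hframe w)
    (fun ω hω v w hv hw => hα ▸ hω.strong hr0.le hrc hTbin hframe v w hv hw) ?_ ?_ ?_ ?_
  · have h1 := norm_expectedGrad_zero_ge (n := n) hm hS' hκ h𝓜 (min_le_left 1 (τ * β)) fun k =>
      (min_le_right _ _).trans
        (mul_le_integral_agreement h𝓜 hτ.le (hTbin M₀ hM₀) (hTβ M₀ hM₀) k)
    refine le_trans (le_of_eq ?_) h1
    rw [hρ, mul_div_cancel₀ _ (by positivity)]
  · have h2 : η ≤ α * ρ / (4 * (d + 1)) := hη ▸ min_le_right _ _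
    rw [le_div_iff₀ (by positivity)] at h2
    rw [← mul_assoc]
    exact mul_le_mul_of_nonneg_right (by linarith) hε0.le
  · refine (measureReal_not_isGoodSample_le hn2 hS' hκ h𝓜 hr0 hκr hβ.le hTβ).trans
      (mul_exp_neg_le_half hT0 hδ0 ?_)
    rw [← hc₁]
    exact hcount _ _ _ hT0 hc₁0 (by linarith) hnC
  · refine mul_exp_neg_le_half hd0 hδ0 ?_
    have h4 : n * (η * ε) ^ 2 / (128 * momentBound m S) = n * ε ^ 2 * c₂ := by rw [hc₂]; ring
    rw [h4]
    exact hcount _ _ _ hd0 hc₂0 (by linarith) hnε
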